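/- Let $F = A_1 * \cdots * A_n * F_k$, where $A_1,\dots,A_n$ are groups and $F_k$ is free of finite rank $k$ with basis $s_1,\dots,s_k$, and let $\mathscr{A}$ be the set of conjugacy classes of the $A_i$. Let $T$ be the Bass--Serre tree of this decomposition: its vertices are the elements $g$ of $F$ and the cosets $gA_i$, and $g$ is joined by an edge to each $gA_i$ and to each $gs_j$. Let $\partial_\infty(F,\mathscr{A}) = \partial_\infty T$ be the Gromov boundary of $T$, and let $\partial(F,\mathscr{A})$ be the union of $\partial_\infty T$ and the set of vertices of $T$ with infinite stabilizer, with the observer's topology (the topology induced from the one on $T \cup \partial_\infty T$ that has the half-trees as a sub-basis). For a subgroup $H \le F$ with minimal subtree $T_H$, let $\partial(H,\mathscr{A}|_H) \subset \partial(F,\mathscr{A})$ be the union of $\partial_\infty T_H$ and the set of vertices of $T_H$ with infinite stabilizer in $H$. A nontrivial element $c \in F$ that is not conjugate into any $A_i$ has exactly two fixed points $\hat T_c^{+}, \hat T_c^{-}$ in $\partial(F,\mathscr{A})$, the endpoints of its axis. Let $\Phi$ be an automorphism of $F$ that permutes the conjugacy classes in $\mathscr{A}$. Then $\Phi$ extends,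 by continuity along the orbit map $F \to T$, to a unique map $\hat\Phi$ of $\partial(F,\mathscr{A})$ to itself, and $\hat\Phi$ is a homeomorphism. Write $\mathbb{F} = \operatorname{Fix}(\Phi)$ and suppose that $\operatorname{Fix}(\hat\Phi)$ contains at least three points of $\partial_\infty(F,\mathscr{A})$. Let $E$ be the set of all points $\hat T_c^{\pm}$, where $c \in \mathbb{F}$ is nontrivial and not conjugate into any $A_i$, and let $\overline{E}$ be its closure in $\partial(F,\mathscr{A})$. 1. $\partial(\mathbb{F},\mathscr{A}|_{\mathbb{F}}) \cap \partial_\infty(F,\mathscr{A}) = \overline{E} \cap \partial_\infty(F,\mathscr{A})$. If this set is nonempty, then moreover $\partial(\mathbb{F},\mathscr{A}|_{\mathbb{F}}) = \overline{E}$, this set is contained in $\operatorname{Fix}(\hat\Phi)$, and none of its points is isolated in $\operatorname{Fix}(\hat\Phi)$. 2. Every point $\xi$ of $\bigl(\operatorname{Fix}(\hat\Phi) \setminus \partial(\mathbb{F},\mathscr{A}|_{\mathbb{F}})\bigr) \cap \partial_\infty(F,\mathscr{A})$ is isolated in $\operatorname{Fix}(\hat\Phi)$ and is an attractor or a repeller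 for $\hat\Phi$; that is, $\xi$ has an open neighbourhood in $\partial(F,\mathscr{A})$ all of whose points converge to $\xi$ under iteration of $\hat\Phi$, or one all of whose points converge to $\xi$ under iteration of $\hat\Phi^{-1}$. -/

import Mathlib

open Filter Topology

namespace FreeProductBoundary

universe u v

/-! ### Trees, half-trees and the observer's topology -/

section Trees

variable {V : Type v}

/-- A singly infinite tight edge path (a path without backtracking) in a graph. -/
structure TightRay (G : SimpleGraph V) where
  /-- the successive vertices of the path -/
  vert : ℕ → V
  adj : ∀ m, G.Adj (vert m) (vert (m + 1))
  tight : ∀ m, vert (m + 2) ≠ vert m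

/-- Two tight rays have the same endpoint at infinity if they share a tail. -/
def tailSetoid (G : SimpleGraph V) : Setoid (TightRay G) where
  r ρ σ := ∃ m m', ∀ j, ρ.vert (m + j) = σ.vert (m' + j)
  iseqv :=
    { refl := fun _ => ⟨0, 0, fun _ => rfl⟩
      symm := fun ⟨m, m', h⟩ => ⟨m', m, fun j => (h j).symm⟩
      trans := by
        rintro ρ σ τ ⟨m, m', h⟩ ⟨p, p', h'⟩
        refine ⟨m + p, p' + m', fun j => ?_⟩
        have h1 := h (p + j)
        have h2 := h' (m' + j)
        rw [show m + p + j = m + (p + j) by ring, h1,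
          show m' + (p + j) = p + (m' + j) by ring, h2,
          show p' + (m' + j) = p' + m' + j by ring] }

/-- The Gromov boundary `∂_∞ T` of a tree `T`. In a tree every class contains exactly one tight ray
starting at a given vertex. -/
def GromovBoundary (G : SimpleGraph V) : Type v := Quotient (tailSetoid G)

/-- The end `e` eventually lies in the vertex set `C`. -/
def GromovBoundary.EventuallyIn {G : SimpleGraph V} (e : GromovBoundary G) (C : Set V) : Prop :=
  Quotient.liftOn e (fun ρ => ∀ᶠ m in atTop, ρ.vert m ∈ C) (by
    have key : ∀ ρ σ : TightRay G, (∃ m m', ∀ j, ρ.vert (m + j) = σ.vert (m' + j)) →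
        (∀ᶠ m in atTop, ρ.vert m ∈ C) → ∀ᶠ m in atTop, σ.vert m ∈ C := by
      rintro ρ σ ⟨m, m', h⟩ hρ
      obtain ⟨N, hN⟩ := eventually_atTop.1 hρ
      refine eventually_atTop.2 ⟨m' + N, fun q hq => ?_⟩
      obtain ⟨d, rfl⟩ := Nat.exists_eq_add_of_le hq
      rw [show m' + N + d = m' + (N + d) by ring, ← h]
      exact hN _ (by omega)
    intro ρ σ h
    exact propext ⟨key ρ σ h, key σ ρ ((tailSetoid G).symm h)⟩)

/-- The union of the vertex set of a tree `T` and of `∂_∞ T`. -/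
inductive Completion (G : SimpleGraph V) : Type v
  | vertex (x : V) : Completion G
  | atInfinity (e : GromovBoundary G) : Completion G

/-- The vertices of the component of `T ∖ {x}` that contains the vertex `y ≠ x`. -/
def component (G : SimpleGraph V) (x y : V) : Set V :=
  {z | ∃ p : G.Walk y z, x ∉ p.support}

/-- The half-tree based at `x` that contains `y ≠ x`: a component of `T ∖ {x}` together with the
ends whose rays run into that component. -/
def halfTree (G : SimpleGraph V) (x y : V) : Set (Completion G) :=
  {z | match z with
    | .vertex w => w ∈ component G x y
    | .atInfinity e => e.EventuallyIn (component G x y)}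

/-- The observer's topology, generated by the half-trees. (Half-trees based at interior points of
edges have the same traces on vertices and ends as those based at vertices.) -/
instance observersTopology (G : SimpleGraph V) : TopologicalSpace (Completion G) :=
  TopologicalSpace.generateFrom {U | ∃ x y : V, y ≠ x ∧ U = halfTree G x y}

end Trees

/-! ### Free products and their Bass–Serre trees -/

variable {F : Type u} [Group F] {n k : ℕ}

/-- `F = A₁ * ⋯ * Aₙ * F_k`, where `F_k` is free on `s₁, …, s_k`. -/
def IsFreeProductDecomposition (A : Fin n → Subgroup F) (s : Fin k → F) : Prop :=
  Function.Bijective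
    (Monoid.Coprod.lift (Monoid.CoprodI.lift fun i => (A i).subtype) (FreeGroup.lift s))

/-- The automorphism `Φ` permutes the conjugacy classes of the subgroups `A i`. -/
def PermutesFactors (A : Fin n → Subgroup F) (Φ : F ≃* F) : Prop :=
  ∃ σ : Equiv.Perm (Fin n), ∀ i, ∃ g : F, ∀ x : F,
    x ∈ (A i).map Φ.toMonoidHom ↔ g⁻¹ * x * g ∈ A (σ i)

/-- The element `c` is conjugate into some `A i`. -/
def IsPeripheral (A : Fin n → Subgroup F) (c : F) : Prop :=
  ∃ i, ∃ g : F, g⁻¹ * c * g ∈ A i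

/-- The vertices of the Bass–Serre tree of the thistle with `n` prickles and `k` petals: the lifts
`g.⋆` of the vertex `⋆` with trivial group, and the cosets `g A i`. -/
abbrev TreeVertex (A : Fin n → Subgroup F) : Type u := F ⊕ (Σ i, F ⧸ A i)

/-- The Bass–Serre tree of the thistle: `g.⋆` is joined to `g A i` for each prickle, and to
`g s_j.⋆` for each petal. -/
def bassSerreTree (A : Fin n → Subgroup F) (s : Fin k → F) : SimpleGraph (TreeVertex A) :=
  SimpleGraph.fromRel fun x y =>
    (∃ (g : F) (i : Fin n), x = Sum.inl g ∧ y = Sum.inr ⟨i, (g : F ⧸ A i)⟩) ∨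
    (∃ (g : F) (j : Fin k), x = Sum.inl g ∧ y = Sum.inl (g * s j))

theorem bassSerreTree_adj_smul (A : Fin n → Subgroup F) (s : Fin k → F) (c : F)
    {x y : TreeVertex A} (h : (bassSerreTree A s).Adj x y) :
    (bassSerreTree A s).Adj (c • x) (c • y) := by
  have key : ∀ x y : TreeVertex A,
      ((∃ (g : F) (i : Fin n), x = Sum.inl g ∧ y = Sum.inr ⟨i, (g : F ⧸ A i)⟩) ∨
        (∃ (g : F) (j : Fin k), x = Sum.inl g ∧ y = Sum.inl (g * s j))) →
      ((∃ (g : F) (i : Fin n), c • x = Sum.inl g ∧ c • y = Sum.inr ⟨i, (g : F ⧸ A i)⟩) ∨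
        (∃ (g : F) (j : Fin k), c • x = Sum.inl g ∧ c • y = Sum.inl (g * s j))) := by
    rintro x y (⟨g, i, rfl, rfl⟩ | ⟨g, j, rfl, rfl⟩)
    · exact Or.inl ⟨c * g, i, rfl, rfl⟩
    · refine Or.inr ⟨c * g, j, rfl, ?_⟩
      rw [mul_assoc]
      rfl
  rw [bassSerreTree, SimpleGraph.fromRel_adj] at h ⊢
  exact ⟨fun e => h.1 (MulAction.injective c e), h.2.imp (key x y) (key y x)⟩

/-- The image of a tight ray under the action of `c`. -/
def TightRay.translate {A : Fin n → Subgroup F} {s : Fin k → F} (c : F)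
    (ρ : TightRay (bassSerreTree A s)) : TightRay (bassSerreTree A s) where
  vert m := c • ρ.vert m
  adj m := bassSerreTree_adj_smul A s c (ρ.adj m)
  tight m h := ρ.tight m (MulAction.injective c h)

/-- The action of `c` on the ends of the Bass–Serre tree. -/
def GromovBoundary.translate {A : Fin n → Subgroup F} {s : Fin k → F} (c : F)
    (e : GromovBoundary (bassSerreTree A s)) : GromovBoundary (bassSerreTree A s) :=
  Quotient.map (sa := tailSetoid _) (sb := tailSetoid _) (TightRay.translate c)
    (by
      rintro ρ σ ⟨m, m', h⟩
      exact ⟨m, m', fun j => congrArg (c • ·) (h j)⟩) e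

/-- The map `T_c` of `T ∪ ∂_∞ T` induced by the action of `c` on the Bass–Serre tree `T`. -/
def translate {A : Fin n → Subgroup F} {s : Fin k → F} (c : F) :
    Completion (bassSerreTree A s) → Completion (bassSerreTree A s)
  | .vertex x => .vertex (c • x)
  | .atInfinity e => .atInfinity (e.translate c)

/-! ### The Bowditch boundary -/

/-- The points of the Bowditch boundary: the ends of the Bass–Serre tree, and its vertices with
infinite stabilizer. -/
def IsBoundaryPoint {A : Fin n → Subgroup F} {s : Fin k → F} :
    Completion (bassSerreTree A s) → Prop
  | .vertex x => Infinite (MulAction.stabilizer F x)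
  | .atInfinity _ => True

/-- The Bowditch boundary `∂(F, 𝒜)`, with the subspace topology of the observer's topology. -/
abbrev Boundary (A : Fin n → Subgroup F) (s : Fin k → F) : Type u :=
  {x : Completion (bassSerreTree A s) // IsBoundaryPoint x}

/-- The subspace `∂_∞(F, 𝒜)` of ends. -/
def boundaryInfty (A : Fin n → Subgroup F) (s : Fin k → F) : Set (Boundary A s) :=
  {ξ | ∃ e, ξ.1 = Completion.atInfinity e}

/-- The orbit map `g ↦ g.⋆`. -/
def orbitPoint (A : Fin n → Subgroup F) (s : Fin k → F) (g : F) :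
    Completion (bassSerreTree A s) :=
  .vertex (Sum.inl g)

/-- The self-map `h` of the boundary is the continuous extension of `Φ`, where `F` is viewed in
`T ∪ ∂_∞ T` by the orbit map: `Φ(g) → h ξ` as `g → ξ`. -/
def IsBoundaryExtension (A : Fin n → Subgroup F) (s : Fin k → F) (Φ : F ≃* F)
    (h : Boundary A s → Boundary A s) : Prop :=
  ∀ ξ : Boundary A s, Tendsto (fun g => orbitPoint A s (Φ g))
    (comap (orbitPoint A s) (𝓝 ξ.1)) (𝓝 (h ξ).1)

/-! ### The boundary of a subgroup -/

/-- The vertex set of the `H`-minimal subtree: the intersection of all (nonempty) `H`-invariant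
subtrees. For trivial `H`, where no minimal subtree is distinguished, it is empty unless the tree
is a point. -/
def minimalSubtree (A : Fin n → Subgroup F) (s : Fin k → F) (H : Subgroup F) :
    Set (TreeVertex A) :=
  ⋂₀ {S | ((bassSerreTree A s).induce S).Connected ∧ ∀ c ∈ H, ∀ x ∈ S, c • x ∈ S}

/-- `∂(H, 𝒜|_H)` as a subset of `∂(F, 𝒜)`: the ends of the minimal subtree of `H`, and its vertices
whose stabilizer in `H` is infinite. -/
def subgroupBoundary (A : Fin n → Subgroup F) (s : Fin k → F) (H : Subgroup F) :
    Set (Boundary A s) :=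
  {ξ | match ξ.1 with
    | .vertex x => x ∈ minimalSubtree A s H ∧
        (H ⊓ MulAction.stabilizer F x : Subgroup F).carrier.Infinite
    | .atInfinity e => ∃ ρ : TightRay (bassSerreTree A s),
        Quotient.mk (tailSetoid _) ρ = e ∧ ∀ m, ρ.vert m ∈ minimalSubtree A s H}

/-- The endpoints of the axes of the nontrivial nonperipheral elements `c` of `H`, that is, the
fixed points of such `c` on the boundary (its source and its sink). -/
def axisEndpoints (A : Fin n → Subgroup F) (s : Fin k → F) (H : Subgroup F) :
    Set (Boundary A s) :=
  {ξ | ∃ c ∈ H, c ≠ 1 ∧ ¬ IsPeripheral A c ∧ translate c ξ.1 = ξ.1}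

/-- The fixed subgroup of an automorphism. -/
def fixedSubgroup (Φ : F ≃* F) : Subgroup F where
  carrier := {c | Φ c = c}
  mul_mem' {a b} (ha : Φ a = a) (hb : Φ b = b) := show Φ (a * b) = a * b by rw [map_mul, ha, hb]
  one_mem' := map_one Φ
  inv_mem' {a} (ha : Φ a = a) := show Φ a⁻¹ = a⁻¹ by rw [map_inv, ha]

/-! ### Dynamics -/

/-- The point `ξ` of `S` is isolated in `S`. -/
def IsIsolatedIn {X : Type*} [TopologicalSpace X] (S : Set X) (ξ : X) : Prop :=
  ∃ U : Set X, IsOpen U ∧ U ∩ S = {ξ}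

/-- The set of points whose forward orbit converges to `ξ` contains an open neighbourhood of
`ξ`. -/
def IsAttractor {X : Type*} [TopologicalSpace X] (h : X ≃ₜ X) (ξ : X) : Prop :=
  ∃ U : Set X, IsOpen U ∧ ξ ∈ U ∧ ∀ ζ ∈ U, Tendsto (fun m : ℕ => h^[m] ζ) atTop (𝓝 ξ)

/-- A repeller is an attractor for the inverse. -/
def IsRepeller {X : Type*} [TopologicalSpace X] (h : X ≃ₜ X) (ξ : X) : Prop :=
  IsAttractor h.symm ξ

end FreeProductBoundary

open FreeProductBoundary

/-!
Removing an edge of the Bass–Serre tree `T` leaves two half-trees, so a completion point is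
recorded by the side of every edge on which it lies, and the observer's topology is the topology of
pointwise convergence of these side functions. Since `Φ` permutes the conjugacy classes of the
factors, it is realized on `T` by a `Φ`-equivariant bijection `f` of the vertices. As `T` has
finitely many orbits of edges, the geodesics between the images under `f` of adjacent vertices run
only finitely often over any given edge; hence `f` extends continuously to the boundary.

An infinity of situations of finitely many types produces, by the pigeonhole principle, two edges
`ε` and `c • ε` in the same situation with `c` fixed by `Φ`. Applied to the edges at a vertex that
point towards axes, this gives infinite stabilizers in the fixed subgroup; applied to the edges of a
ray, it gives an axis of a fixed element close to the end of the ray. So at a fixed end that is not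
a limit of axis endpoints only finitely many edges of the ray are in any of these situations, and
far out on the ray `f` or its inverse maps every half-tree into itself. A point of such a half-tree
whose orbit fails to advance towards the end within two steps would produce another situation of
finitely many types, so the end attracts.
-/

namespace FreeProductBoundary

universe u v w

/-! ### Trees described by the sides of their edges -/

/-- A tree, presented as a connected graph with a labelling of its edges by `E` and, for each edge,
a two-colouring of the vertices that changes across that edge only. The colour classes are the two
sides of the edge. -/
structure SidedTree {V : Type v} (G : SimpleGraph V) (E : Type w) where
  /-- the initial vertex of an edge -/
  src : E → V
  /-- the terminal vertex of an edge -/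
  tgt : E → V
  /-- the side of an edge on which a vertex lies -/
  side : E → V → Bool
  adj_iff : ∀ x y, G.Adj x y ↔ ∃ ε, (src ε = x ∧ tgt ε = y) ∨ (src ε = y ∧ tgt ε = x)
  side_src : ∀ ε, side ε (src ε) = false
  side_tgt : ∀ ε, side ε (tgt ε) = true
  side_src_eq_side_tgt : ∀ ε ε', ε ≠ ε' → side ε (src ε') = side ε (tgt ε')
  preconnected : G.Preconnected

namespace SidedTree

variable {V : Type v} {G : SimpleGraph V} {E : Type w} (S : SidedTree G E)

/-- The edge `ε`, with one of its two orientations, runs from `x` to `y`. -/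
def Joins (ε : E) (x y : V) : Prop :=
  (S.src ε = x ∧ S.tgt ε = y) ∨ (S.src ε = y ∧ S.tgt ε = x)

/-- The edges separating two vertices, which are those of the geodesic between them. -/
def sep (x y : V) : Set E := {ε | S.side ε x ≠ S.side ε y}

/-- The edges with exactly one endpoint in `C`. -/
def coboundary (C : Set V) : Set E := {ε | ¬(S.src ε ∈ C ↔ S.tgt ε ∈ C)}

theorem joins_src_tgt (ε : E) : S.Joins ε (S.src ε) (S.tgt ε) := Or.inl ⟨rfl, rfl⟩

theorem exists_joins {x y : V} (h : G.Adj x y) : ∃ ε, S.Joins ε x y := (S.adj_iff x y).1 h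

theorem exists_joins_side_eq (ε : E) (b : Bool) : ∃ x y, S.Joins ε x y ∧ S.side ε x = b := by
  cases b
  · exact ⟨_, _, Or.inl ⟨rfl, rfl⟩, S.side_src ε⟩
  · exact ⟨_, _, Or.inr ⟨rfl, rfl⟩, S.side_tgt ε⟩

variable {S} {ε ε' : E} {x y z u : V} {C : Set V}

theorem mem_sep : ε ∈ S.sep x y ↔ S.side ε x ≠ S.side ε y := Iff.rfl

theorem notMem_sep : ε ∉ S.sep x y ↔ S.side ε x = S.side ε y := not_not

theorem sep_comm (x y : V) : S.sep x y = S.sep y x := Set.ext fun _ => ne_comm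

theorem mem_sep_or_mem_sep (h : ε ∈ S.sep x z) (y : V) : ε ∈ S.sep x y ∨ ε ∈ S.sep y z := by
  by_contra! hc
  exact h ((notMem_sep.1 hc.1).trans (notMem_sep.1 hc.2))

namespace Joins

theorem symm (h : S.Joins ε x y) : S.Joins ε y x := Or.symm h

theorem adj (h : S.Joins ε x y) : G.Adj x y := (S.adj_iff x y).2 ⟨ε, h⟩

theorem side_ne (h : S.Joins ε x y) : S.side ε x ≠ S.side ε y := by
  rcases h with ⟨rfl, rfl⟩ | ⟨rfl, rfl⟩ <;> simp [S.side_src, S.side_tgt]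

theorem side_eq (h : S.Joins ε x y) (hne : ε' ≠ ε) : S.side ε' x = S.side ε' y := by
  rcases h with ⟨rfl, rfl⟩ | ⟨rfl, rfl⟩
  · exact S.side_src_eq_side_tgt _ _ hne
  · exact (S.side_src_eq_side_tgt _ _ hne).symm

theorem mem_sep_iff (h : S.Joins ε x y) : ε' ∈ S.sep x y ↔ ε' = ε :=
  ⟨fun h' => by_contra fun hne => h' (h.side_eq hne), fun e => e ▸ h.side_ne⟩

theorem mem_coboundary_iff (h : S.Joins ε x y) : ε ∈ S.coboundary C ↔ ¬(x ∈ C ↔ y ∈ C) := by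
  rcases h with ⟨rfl, rfl⟩ | ⟨rfl, rfl⟩
  · exact Iff.rfl
  · exact not_congr Iff.comm

theorem eq_of_side_eq {x' y' : V} (h : S.Joins ε x y) (h' : S.Joins ε x' y')
    (hs : S.side ε x = S.side ε x') : x = x' ∧ y = y' := by
  rcases h with ⟨rfl, rfl⟩ | ⟨rfl, rfl⟩ <;> rcases h' with ⟨rfl, rfl⟩ | ⟨rfl, rfl⟩ <;>
    simp_all [S.side_src, S.side_tgt]

theorem sep_eq (h : S.Joins ε x u) (hε : ε ∈ S.sep x y) : S.sep u y = S.sep x y \ {ε} := by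
  ext ε'
  rcases eq_or_ne ε' ε with rfl | hne
  · have hu : S.side ε' u = S.side ε' y := (Bool.eq_not.2 h.side_ne.symm).trans (Bool.eq_not.2
      (mem_sep.1 hε).symm).symm
    simp [mem_sep, hu]
  · simp [mem_sep, h.side_eq hne, hne]

end Joins

variable (S) in
theorem sep_finite (x y : V) : (S.sep x y).Finite := by
  obtain ⟨p⟩ := S.preconnected x y
  induction p with
  | nil => simp [sep]
  | cons h _ ih =>
    obtain ⟨ε, hε⟩ := S.exists_joins h
    exact (ih.insert ε).subset fun ε' h' =>
      (mem_sep_or_mem_sep h' _).imp hε.mem_sep_iff.1 id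

theorem Joins.side_eq_of_walk (h : S.Joins ε x u) (p : G.Walk y z) (hp : x ∉ p.support) :
    S.side ε y = S.side ε z := by
  induction p with
  | nil => rfl
  | @cons a b c hab p ih =>
    rw [SimpleGraph.Walk.support_cons, List.mem_cons, not_or] at hp
    obtain ⟨ε', hε'⟩ := S.exists_joins hab
    refine (hε'.side_eq ?_).trans (ih hp.2)
    rintro rfl
    rcases Bool.eq_or_eq_not (S.side ε x) (S.side ε a) with hs | hs
    · exact hp.1 (h.eq_of_side_eq hε' hs).1
    · have hb : S.side ε x = S.side ε b := hs.trans (Bool.eq_not.2 hε'.side_ne.symm).symm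
      exact hp.2 ((h.eq_of_side_eq hε'.symm hb).1 ▸ p.start_mem_support)

variable (S) in
theorem exists_first_edge (hne : x ≠ y) : ∃ ε u, S.Joins ε x u ∧ ε ∈ S.sep x y := by
  classical
  obtain ⟨p, hp⟩ := (S.preconnected x y).exists_isPath
  cases p with
  | nil => exact absurd rfl hne
  | cons hab p =>
    obtain ⟨ε, hε⟩ := S.exists_joins hab
    rw [SimpleGraph.Walk.cons_isPath_iff] at hp
    exact ⟨ε, _, hε, fun e => hε.side_ne (e.trans (hε.side_eq_of_walk p hp.2).symm)⟩

variable (S) in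
theorem eq_of_side_eq (h : ∀ ε, S.side ε x = S.side ε y) : x = y := by
  by_contra hne
  obtain ⟨ε, _, -, hε⟩ := S.exists_first_edge hne
  exact hε (h ε)

variable (S) in
theorem geodesic_induction (y : V) {P : V → Prop} (base : P y)
    (step : ∀ x u ε, S.Joins ε x u → ε ∈ S.sep x y → S.sep u y = S.sep x y \ {ε} → P u → P x)
    (x : V) : P x := by
  induction hn : (S.sep x y).ncard generalizing x with
  | zero =>
    rw [Set.ncard_eq_zero (S.sep_finite x y)] at hn
    have hxy : x = y := S.eq_of_side_eq fun ε => notMem_sep.1 (hn ▸ Set.notMem_empty ε)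
    rwa [hxy]
  | succ m ih =>
    have hne : x ≠ y := by
      rintro rfl
      simp [sep] at hn
    obtain ⟨ε, u, hj, hε⟩ := S.exists_first_edge hne
    have hu := hj.sep_eq hε
    refine step x u ε hj hε hu (ih u ?_)
    rw [hu, Set.ncard_sdiff_singleton_of_mem hε, hn, Nat.add_sub_cancel]

variable (S) in
theorem exists_geodesic_walk (x y : V) :
    ∃ p : G.Walk x y, ∀ v ∈ p.support, S.sep x v ⊆ S.sep x y := by
  induction x using S.geodesic_induction y with
  | base => exact ⟨.nil, by simp⟩
  | step x u ε hj hε hu ih =>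
    obtain ⟨p, hp⟩ := ih
    refine ⟨.cons hj.adj p, fun v hv ε' hε' => ?_⟩
    rcases List.mem_cons.1 (SimpleGraph.Walk.support_cons _ _ ▸ hv) with rfl | hv
    · exact absurd rfl hε'
    · rcases mem_sep_or_mem_sep hε' u with h | h
      · rwa [hj.mem_sep_iff.1 h]
      · exact (hu ▸ hp v hv h).1

theorem component_eq (hj : S.Joins ε x u) (hε : ε ∈ S.sep x y) :
    component G x y = {z | S.side ε z = S.side ε y} := by
  ext z
  constructor
  · rintro ⟨p, hp⟩
    exact (hj.side_eq_of_walk p hp).symm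
  · intro hz
    obtain ⟨p, hp⟩ := S.exists_geodesic_walk y z
    exact ⟨p, fun hx => hp x hx ((sep_comm x y) ▸ hε) (Eq.symm hz)⟩

theorem Joins.side_eq_of_mem_sep {e : E} {a b : V} (hj : S.Joins ε a b) (hε : ε ∈ S.sep x y)
    (he : e ∉ S.sep x y) : S.side e a = S.side e x := by
  induction x using S.geodesic_induction y with
  | base => exact absurd rfl hε
  | step x u ε₀ hj₀ hε₀ hu ih =>
    have hxu : S.side e u = S.side e x := (hj₀.side_eq (ne_of_mem_of_not_mem hε₀ he).symm).symm
    rcases eq_or_ne ε ε₀ with rfl | hne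
    · rcases Bool.eq_or_eq_not (S.side ε a) (S.side ε x) with hs | hs
      · rw [(hj.eq_of_side_eq hj₀ hs).1]
      · rw [(hj.eq_of_side_eq hj₀.symm (hs.trans (Bool.eq_not.2 hj₀.side_ne.symm).symm)).1, hxu]
    · rw [hu] at ih
      exact (ih ⟨hε, hne⟩ fun h => he h.1).trans hxu

theorem Joins.notMem_sep_of_ne (hj : S.Joins ε x u) (hj' : S.Joins ε' x z) (hne : ε' ≠ ε)
    (hε : ε ∈ S.sep x y) : ε' ∉ S.sep x y := by
  intro hε'
  have hsep := hj.sep_eq hε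
  have hε'sep : ε' ∈ S.sep u y := hsep ▸ ⟨hε', hne⟩
  exact hj.side_ne (hj'.side_eq_of_mem_sep hε'sep (by simp [hsep]))

theorem exists_mem_sep_mem_coboundary (hx : x ∈ C) (hy : y ∉ C) :
    ∃ ε ∈ S.sep x y, ε ∈ S.coboundary C := by
  induction x using S.geodesic_induction y with
  | base => exact absurd hx hy
  | step x u ε hj hε hu ih =>
    by_cases huC : u ∈ C
    · obtain ⟨ε', h, h'⟩ := ih huC
      exact ⟨ε', (hu ▸ h).1, h'⟩
    · exact ⟨ε, hε, by simp [hj.mem_coboundary_iff, hx, huC]⟩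

theorem mem_iff_mem_of_disjoint_coboundary (h : ∀ ε ∈ S.coboundary C, ε ∉ S.sep x y) :
    x ∈ C ↔ y ∈ C := by
  constructor <;> intro hx <;> by_contra hy <;>
    obtain ⟨ε, h1, h2⟩ := exists_mem_sep_mem_coboundary (S := S) hx hy
  · exact h ε h2 h1
  · exact h ε h2 (sep_comm y x ▸ h1)

variable (S) in
theorem coboundary_side (ε : E) (b : Bool) : S.coboundary {x | S.side ε x = b} = {ε} := by
  ext ε'
  simp only [coboundary, Set.mem_ofPred_eq, Set.mem_singleton_iff]
  rcases eq_or_ne ε ε' with rfl | hne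
  · cases b <;> simp [S.side_src, S.side_tgt]
  · simp [S.side_src_eq_side_tgt _ _ hne, hne.symm]

/-! ### Tight rays -/

variable (S) in
/-- The `m`-th edge of a tight ray. -/
noncomputable def rayEdge (ρ : TightRay G) (m : ℕ) : E := (S.exists_joins (ρ.adj m)).choose

variable (S) in
theorem joins_rayEdge (ρ : TightRay G) (m : ℕ) :
    S.Joins (S.rayEdge ρ m) (ρ.vert m) (ρ.vert (m + 1)) :=
  (S.exists_joins (ρ.adj m)).choose_spec

theorem rayEdge_succ_ne (ρ : TightRay G) (m : ℕ) : S.rayEdge ρ (m + 1) ≠ S.rayEdge ρ m := by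
  intro he
  have hj := S.joins_rayEdge ρ (m + 1)
  rw [he] at hj
  exact ρ.tight m ((S.joins_rayEdge ρ m).symm.eq_of_side_eq hj rfl).2.symm

theorem side_rayEdge_of_lt (ρ : TightRay G) {m j : ℕ} (h : m < j) :
    S.side (S.rayEdge ρ m) (ρ.vert j) = S.side (S.rayEdge ρ m) (ρ.vert (m + 1)) := by
  obtain ⟨d, rfl⟩ := Nat.exists_eq_add_of_le (Nat.succ_le_of_lt h)
  clear h
  induction d generalizing m with
  | zero => rfl
  | succ d ih =>
    rw [← ih, ← Nat.add_assoc]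
    refine ((S.joins_rayEdge ρ (m + 1 + d)).side_eq fun he => ?_).symm
    -- Crossing the same edge again, the ray would return to `ρ.vert m`, against `ih` at `m + 1`.
    have hj := S.joins_rayEdge ρ (m + 1 + d)
    rw [← he] at hj
    have hreturn := ((S.joins_rayEdge ρ m).symm.eq_of_side_eq hj ih.symm).2
    have hnext := ih (m := m + 1)
    rw [Nat.succ_eq_add_one, show m + 1 + 1 + d = m + 1 + d + 1 by omega, ← hreturn,
      (S.joins_rayEdge ρ m).side_eq (rayEdge_succ_ne ρ m)] at hnext
    exact (S.joins_rayEdge ρ (m + 1)).side_ne hnext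

theorem rayEdge_injective (ρ : TightRay G) : Function.Injective (S.rayEdge ρ) := by
  refine .of_lt_imp_ne fun a b hlt he => ?_
  have hj := S.joins_rayEdge ρ b
  rw [← he] at hj
  exact hj.side_ne ((side_rayEdge_of_lt ρ hlt).trans (side_rayEdge_of_lt ρ (by omega)).symm)

theorem side_rayEdge_of_le (ρ : TightRay G) {m j : ℕ} (h : j ≤ m) :
    S.side (S.rayEdge ρ m) (ρ.vert j) = S.side (S.rayEdge ρ m) (ρ.vert m) := by
  induction h using Nat.decreasingInduction with
  | self => rfl
  | of_succ j hj ih =>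
    exact ((S.joins_rayEdge ρ j).side_eq ((rayEdge_injective ρ).ne (by omega))).trans ih

variable (S) in
include S in
theorem vert_injective (ρ : TightRay G) : Function.Injective ρ.vert := by
  refine .of_lt_imp_ne fun a b hlt he => ?_
  exact (S.joins_rayEdge ρ a).side_ne (he ▸ side_rayEdge_of_lt ρ hlt)

end SidedTree

/-! ### Vertices near a point of the completion -/

/-- The point at infinity of the completed tree that a tight ray runs to. -/
abbrev TightRay.endpoint {V : Type v} {G : SimpleGraph V} (ρ : TightRay G) : Completion G :=
  .atInfinity (Quotient.mk (tailSetoid G) ρ)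

/-- The filter of vertex sets that contain the vertex `z`, or into which the end `z` runs. -/
def Completion.near {V : Type v} {G : SimpleGraph V} : Completion G → Filter V
  | .vertex x => pure x
  | .atInfinity e => Quotient.lift (s := tailSetoid G) (fun ρ => map ρ.vert atTop) (by
      rintro ρ σ ⟨m, m', h⟩
      have htail : ∀ (τ : TightRay G) m, map τ.vert atTop = map (fun j => τ.vert (m + j)) atTop :=
        fun τ m => by
          conv_lhs => rw [← map_add_atTop_eq_nat m, map_map]
          simp only [Function.comp_def, add_comm]
      exact (htail ρ m).trans (by simp only [h, ← htail σ m'])) e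

theorem Completion.induction {V : Type v} {G : SimpleGraph V} {P : Completion G → Prop}
    (vertex : ∀ x, P (.vertex x)) (endpoint : ∀ ρ : TightRay G, P ρ.endpoint) (z : Completion G) :
    P z := by
  cases z with
  | vertex x => exact vertex x
  | atInfinity e => exact Quotient.inductionOn e endpoint

instance Completion.near_neBot {V : Type v} {G : SimpleGraph V} (z : Completion G) :
    z.near.NeBot := by
  induction z using Completion.induction with
  | vertex x => exact pure_neBot
  | endpoint ρ => exact map_neBot

theorem mem_halfTree_iff {V : Type v} {G : SimpleGraph V} {x y : V} {z : Completion G} :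
    z ∈ halfTree G x y ↔ component G x y ∈ z.near := by
  induction z using Completion.induction <;> exact Iff.rfl

namespace SidedTree

variable {V : Type v} {G : SimpleGraph V} {E : Type w} {S : SidedTree G E}
  {ε : E} {b : Bool} {C : Set V} {z z' : Completion G} {ρ : TightRay G}

theorem eventually_rayEdge_notMem (ρ : TightRay G) {Q : Set E} (hQ : Q.Finite) :
    ∀ᶠ t in atTop, S.rayEdge ρ t ∉ Q :=
  Nat.cofinite_eq_atTop ▸ (rayEdge_injective ρ).tendsto_cofinite.eventually
    hQ.eventually_cofinite_notMem

theorem mem_near_or_compl_mem_near (hC : (S.coboundary C).Finite) (z : Completion G) :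
    C ∈ z.near ∨ Cᶜ ∈ z.near := by
  induction z using Completion.induction with
  | vertex x => exact em (x ∈ C)
  | endpoint ρ =>
    obtain ⟨N, hN⟩ := eventually_atTop.1 (eventually_rayEdge_notMem ρ hC)
    have hconst : ∀ m ≥ N, ρ.vert m ∈ C ↔ ρ.vert N ∈ C := fun m hm => by
      induction m, hm using Nat.le_induction with
      | base => rfl
      | succ m hm ih =>
        exact (not_not.1 ((S.joins_rayEdge ρ m).mem_coboundary_iff.not.1 (hN m hm))).symm.trans ih
    by_cases hmem : ρ.vert N ∈ C
    · exact Or.inl (eventually_atTop.2 ⟨N, fun m hm => (hconst m hm).2 hmem⟩)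
    · exact Or.inr (eventually_atTop.2 ⟨N, fun m hm => (hconst m hm).not.2 hmem⟩)

open Classical in
variable (S) in
/-- The side of an edge on which a point of the completion lies. -/
noncomputable def limSide (ε : E) (z : Completion G) : Bool :=
  decide (∀ᶠ x in z.near, S.side ε x = true)

variable (S) in
theorem eventually_side (ε : E) (z : Completion G) :
    ∀ᶠ x in z.near, S.side ε x = S.limSide ε z := by
  have hfin : (S.coboundary {x | S.side ε x = true}).Finite := by simp [coboundary_side]
  by_cases h : ∀ᶠ x in z.near, S.side ε x = true
  · simp [limSide, h]
  · filter_upwards [(mem_near_or_compl_mem_near hfin z).resolve_left h] with x hx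
    simpa [limSide, h] using hx

theorem limSide_eq_of_frequently (h : ∃ᶠ x in z.near, S.side ε x = b) : S.limSide ε z = b := by
  obtain ⟨x, hx, hlim⟩ := (h.and_eventually (S.eventually_side ε z)).exists
  exact hlim.symm.trans hx

theorem limSide_eq_iff : S.limSide ε z = b ↔ ∀ᶠ x in z.near, S.side ε x = b :=
  ⟨fun h => h ▸ S.eventually_side ε z, fun h => limSide_eq_of_frequently h.frequently⟩

@[simp] theorem limSide_vertex (ε : E) (x : V) : S.limSide ε (.vertex x) = S.side ε x :=
  limSide_eq_iff.2 rfl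

theorem limSide_endpoint_eq_iff :
    S.limSide ε ρ.endpoint = b ↔ ∀ᶠ m in atTop, S.side ε (ρ.vert m) = b :=
  limSide_eq_iff

theorem limSide_rayEdge (ρ : TightRay G) (m : ℕ) :
    S.limSide (S.rayEdge ρ m) ρ.endpoint = S.side (S.rayEdge ρ m) (ρ.vert (m + 1)) :=
  limSide_endpoint_eq_iff.2 (eventually_atTop.2 ⟨m + 1, fun _ hj => side_rayEdge_of_lt ρ hj⟩)

variable (S) in
theorem eventually_forall_side (z : Completion G) {Q : Set E} (hQ : Q.Finite) :
    ∀ᶠ x in z.near, ∀ e ∈ Q, S.side e x = S.limSide e z :=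
  (eventually_all_finite hQ).2 fun e _ => S.eventually_side e z

theorem Joins.side_eq_of_limSide_ne {e : E} {x y : V} (hj : S.Joins ε x y)
    (hε : S.limSide ε z ≠ S.limSide ε z') (he : S.limSide e z = S.limSide e z') :
    S.side e x = S.limSide e z := by
  obtain ⟨p, hp⟩ := (S.eventually_forall_side z (Set.toFinite {ε, e})).exists
  obtain ⟨p', hp'⟩ := (S.eventually_forall_side z' (Set.toFinite {ε, e})).exists
  simp only [Set.forall_mem_insert, Set.mem_singleton_iff, forall_eq] at hp hp'
  rw [← hp.2]
  refine hj.side_eq_of_mem_sep (y := p') ?_ ?_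
  · rwa [mem_sep, hp.1, hp'.1]
  · rwa [notMem_sep, hp.2, hp'.2]

theorem mem_near_of_limSide_eq (hC : (S.coboundary C).Finite)
    (h : ∀ ε ∈ S.coboundary C, S.limSide ε z = S.limSide ε z') (hz : C ∈ z.near) :
    C ∈ z'.near := by
  refine (mem_near_or_compl_mem_near hC z').resolve_right fun hz' => ?_
  obtain ⟨x, hx, hxC⟩ := ((S.eventually_forall_side z hC).and hz).exists
  obtain ⟨y, hy, hyC⟩ := ((S.eventually_forall_side z' hC).and hz').exists
  refine hyC ((mem_iff_mem_of_disjoint_coboundary (S := S) fun ε hε => ?_).1 hxC)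
  rw [notMem_sep, hx ε hε, hy ε hε, h ε hε]

/-! ### The observer's topology in terms of sides -/

theorem halfTree_eq {x u y : V} (hj : S.Joins ε x u) (hε : ε ∈ S.sep x y) :
    halfTree G x y = {z | S.limSide ε z = S.side ε y} := by
  ext z
  rw [mem_halfTree_iff, component_eq hj hε]
  exact limSide_eq_iff.symm

variable (S) in
theorem isOpen_limSide_eq (ε : E) (b : Bool) : IsOpen {z : Completion G | S.limSide ε z = b} := by
  have hopen : ∀ x y, S.Joins ε x y → IsOpen {z : Completion G | S.limSide ε z = S.side ε y} :=
    fun x y hj => TopologicalSpace.isOpen_generateFrom_of_mem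
      ⟨x, y, hj.adj.ne', (halfTree_eq hj hj.side_ne).symm⟩
  cases b
  · exact S.side_src ε ▸ hopen _ _ (S.joins_src_tgt ε).symm
  · exact S.side_tgt ε ▸ hopen _ _ (S.joins_src_tgt ε)

variable (S) in
theorem isInducing_limSide : IsInducing fun (z : Completion G) (ε : E) => S.limSide ε z := by
  refine ⟨le_antisymm ?_ (le_generateFrom ?_)⟩
  · rw [← continuous_iff_le_induced]
    exact continuous_pi fun ε => continuous_discrete_rng.2 (S.isOpen_limSide_eq ε)
  · rintro U ⟨x, y, hne, rfl⟩
    obtain ⟨ε, u, hj, hε⟩ := S.exists_first_edge hne.symm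
    rw [halfTree_eq hj hε]
    have hcont : Continuous fun g : E → Bool => g ε := continuous_apply ε
    exact isOpen_induced_iff.2 ⟨{g | g ε = S.side ε y},
      (isOpen_discrete {S.side ε y}).preimage hcont, rfl⟩

variable (S) in
theorem tendsto_nhds_iff {α : Type*} {l : Filter α} {g : α → Completion G} :
    Tendsto g l (𝓝 z) ↔ ∀ ε, ∀ᶠ a in l, S.limSide ε (g a) = S.limSide ε z := by
  rw [S.isInducing_limSide.tendsto_nhds_iff, tendsto_pi_nhds]
  simp [nhds_discrete, tendsto_pure]

variable (S) in
theorem eventually_limSide_eq (ε : E) (z : Completion G) :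
    ∀ᶠ z' in 𝓝 z, S.limSide ε z' = S.limSide ε z :=
  (S.isOpen_limSide_eq ε _).mem_nhds rfl

variable (S) in
theorem hasBasis_nhds (z : Completion G) :
    (𝓝 z).HasBasis (fun Q : Set E => Q.Finite)
      (fun Q => {z' | ∀ ε ∈ Q, S.limSide ε z' = S.limSide ε z}) := by
  refine ⟨fun U => ⟨fun hU => ?_, fun ⟨Q, hQ, hsub⟩ => ?_⟩⟩
  · rw [S.isInducing_limSide.nhds_eq_comap, nhds_pi, mem_comap] at hU
    obtain ⟨W, hW, hWU⟩ := hU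
    obtain ⟨Q, hQ, t, ht, hsub⟩ := Filter.mem_pi.1 hW
    refine ⟨Q, hQ, fun z' hz' => hWU (hsub fun ε hε => ?_)⟩
    change S.limSide ε z' ∈ t ε
    exact hz' ε hε ▸ mem_of_mem_nhds (ht ε)
  · exact mem_of_superset
      ((eventually_all_finite hQ).2 fun ε _ => S.eventually_limSide_eq ε z) hsub

/-! ### Points of the completion as orientations -/

theorem exists_side_ne_limSide_endpoint (x : V) (ρ : TightRay G) :
    ∃ ε, S.side ε x ≠ S.limSide ε ρ.endpoint := by
  obtain ⟨t, ht⟩ := (eventually_rayEdge_notMem ρ (S.sep_finite (ρ.vert 0) x)).exists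
  refine ⟨S.rayEdge ρ t, ?_⟩
  rw [← notMem_sep.1 ht, limSide_rayEdge, side_rayEdge_of_le ρ (Nat.zero_le t)]
  exact (S.joins_rayEdge ρ t).side_ne

theorem side_vert_eq (h : ∀ m, S.rayEdge ρ m ≠ ε) (m : ℕ) :
    S.side ε (ρ.vert m) = S.side ε (ρ.vert 0) := by
  induction m with
  | zero => rfl
  | succ m ih => rw [← ih, (S.joins_rayEdge ρ m).side_eq (h m).symm]

theorem limSide_endpoint_eq_side (h : ∀ m, S.rayEdge ρ m ≠ ε) (m : ℕ) :
    S.limSide ε ρ.endpoint = S.side ε (ρ.vert m) :=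
  limSide_endpoint_eq_iff.2
    (.of_forall fun j => (side_vert_eq h j).trans (side_vert_eq h m).symm)

theorem endpoint_eq_of_limSide_eq {σ : TightRay G}
    (h : ∀ ε, S.limSide ε ρ.endpoint = S.limSide ε σ.endpoint) : ρ.endpoint = σ.endpoint := by
  obtain ⟨T, hT⟩ := eventually_atTop.1
    (eventually_rayEdge_notMem (S := S) ρ (S.sep_finite (ρ.vert 0) (σ.vert 0)))
  have hedge : ∀ t ≥ T, ∃ m, ρ.vert t = σ.vert m ∧ ρ.vert (t + 1) = σ.vert (m + 1) := by
    intro t ht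
    have hside : S.side (S.rayEdge ρ t) (σ.vert 0) = S.side (S.rayEdge ρ t) (ρ.vert t) := by
      rw [← notMem_sep.1 (hT t ht), side_rayEdge_of_le ρ (Nat.zero_le t)]
    obtain ⟨m, hm⟩ : ∃ m, S.rayEdge σ m = S.rayEdge ρ t := by
      by_contra! hne
      refine (S.joins_rayEdge ρ t).side_ne ?_
      rw [← hside, ← limSide_endpoint_eq_side hne 0, ← h, limSide_rayEdge]
    refine ⟨m, (S.joins_rayEdge ρ t).eq_of_side_eq (hm ▸ S.joins_rayEdge σ m) ?_⟩
    rw [← hside, ← hm, side_rayEdge_of_le σ (Nat.zero_le m)]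
  obtain ⟨m, hm, -⟩ := hedge T le_rfl
  refine congrArg Completion.atInfinity (Quotient.sound (s := tailSetoid G) ⟨T, m, fun j => ?_⟩)
  induction j with
  | zero => exact hm
  | succ j ih =>
    obtain ⟨m', h1, h2⟩ := hedge (T + j) (by omega)
    rw [← add_assoc, h2, S.vert_injective σ (h1.symm.trans ih), add_assoc]

variable (S) in
theorem ext_limSide (h : ∀ ε, S.limSide ε z = S.limSide ε z') : z = z' := by
  induction z using Completion.induction <;> induction z' using Completion.induction
  case vertex.vertex x y => exact congrArg _ (S.eq_of_side_eq (by simpa using h))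
  case vertex.endpoint x ρ =>
    obtain ⟨ε, hε⟩ := exists_side_ne_limSide_endpoint (S := S) x ρ
    exact absurd (by simpa using h ε) hε
  case endpoint.vertex ρ x =>
    obtain ⟨ε, hε⟩ := exists_side_ne_limSide_endpoint (S := S) x ρ
    exact absurd (by simpa using (h ε).symm) hε
  case endpoint.endpoint ρ σ => exact endpoint_eq_of_limSide_eq h

include S in
variable (S) in
theorem t2Space_completion : T2Space (Completion G) :=
  Topology.IsEmbedding.t2Space
    ⟨S.isInducing_limSide, fun _ _ h => S.ext_limSide fun ε => congrFun h ε⟩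

variable (S) in
/-- An orientation of the edges of a tree, given as a choice of a side of each edge, is consistent
if any two of the chosen sides meet. Such an orientation points towards a point of the completion,
see `Consistent.exists_limSide_eq`. -/
def Consistent (o : E → Bool) : Prop := ∀ e e', ∃ p, S.side e p = o e ∧ S.side e' p = o e'

namespace Consistent

variable {o : E → Bool} {ε' : E} {x u u' : V}

theorem exists_outgoing_edge (ho : S.Consistent o) (hε : S.side ε x ≠ o ε) {y : V}
    (hy : S.side ε y = o ε) :
    ∃ ε' u, S.Joins ε' x u ∧ S.side ε' x ≠ o ε' ∧ ε' ∈ S.sep x y := by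
  obtain ⟨ε', u, hj, hsep⟩ := S.exists_first_edge (x := x) (y := y) fun e => hε (e ▸ hy)
  refine ⟨ε', u, hj, fun hx => ?_, hsep⟩
  -- Otherwise `ε'` separates `y` from a vertex beyond `ε`, so `x` also lies beyond `ε`.
  obtain ⟨p, hp, hp'⟩ := ho ε ε'
  have hsep' : ε' ∈ S.sep y p := by
    rw [mem_sep, hp', ← hx]
    exact Ne.symm hsep
  exact hε ((hj.side_eq_of_mem_sep hsep' (notMem_sep.2 (hy.trans hp.symm))).trans hy)

theorem outgoing_edge_unique (ho : S.Consistent o) (hj : S.Joins ε x u) (hj' : S.Joins ε' x u')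
    (hε : S.side ε x ≠ o ε) (hε' : S.side ε' x ≠ o ε') : ε = ε' := by
  by_contra hne
  obtain ⟨p, hp, hp'⟩ := ho ε ε'
  have hu' : S.side ε' u' = o ε' :=
    (Bool.eq_not.2 hj'.side_ne.symm).trans (Bool.eq_not.2 hε'.symm).symm
  have hsep : ε ∈ S.sep u' p := by
    rwa [mem_sep, hp, ← hj'.side_eq hne]
  exact hε' ((hj.side_eq_of_mem_sep hsep (notMem_sep.2 (hu'.trans hp'.symm))).trans hu')

theorem exists_ray [Nonempty V] (ho : S.Consistent o) (hx : ∀ x, ∃ ε, S.side ε x ≠ o ε) :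
    ∃ ρ : TightRay G, ∀ m, S.side (S.rayEdge ρ m) (ρ.vert m) ≠ o (S.rayEdge ρ m) := by
  have hout : ∀ x, ∃ u ε, S.Joins ε x u ∧ S.side ε x ≠ o ε := fun x => by
    obtain ⟨ε, hε⟩ := hx x
    obtain ⟨y, hy, -⟩ := ho ε ε
    obtain ⟨ε', u, hj, hne, -⟩ := ho.exists_outgoing_edge hε hy
    exact ⟨u, ε', hj, hne⟩
  choose next edge hjoins hside using hout
  have hnext_next : ∀ x, next (next x) ≠ x := fun x h => by
    have hj : S.Joins (edge (next x)) (next x) x  :=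
      Eq.subst (motive := S.Joins (edge (next x)) (next x)) h (hjoins (next x))
    have he : edge x = edge (next x) := hj.mem_sep_iff.1 (hjoins x).symm.side_ne
    refine (hjoins x).side_ne ((Bool.eq_not.2 (hside x)).trans (Bool.eq_not.2 ?_).symm)
    exact he ▸ hside (next x)
  obtain ⟨x₀⟩ := ‹Nonempty V›
  have hsucc : ∀ m, next^[m + 1] x₀ = next (next^[m] x₀) := fun m =>
    Function.iterate_succ_apply' _ _ _
  refine ⟨⟨fun m => next^[m] x₀, fun m => ?_, fun m => ?_⟩, fun m => ?_⟩
  · rw [hsucc]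
    exact (hjoins _).adj
  · rw [hsucc, hsucc]
    exact hnext_next _
  · set ρ : TightRay G := ⟨fun m => next^[m] x₀, _, _⟩
    have hj : S.Joins (edge (ρ.vert m)) (ρ.vert m) (ρ.vert (m + 1)) := by
      simpa only [ρ, hsucc] using hjoins (next^[m] x₀)
    rw [hj.mem_sep_iff.1 (S.joins_rayEdge ρ m).side_ne]
    exact hside _

theorem limSide_endpoint (ho : S.Consistent o)
    (hρ : ∀ m, S.side (S.rayEdge ρ m) (ρ.vert m) ≠ o (S.rayEdge ρ m)) (ε : E) :
    S.limSide ε ρ.endpoint = o ε := by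
  by_cases hray : ∃ m, S.rayEdge ρ m = ε
  · obtain ⟨m, rfl⟩ := hray
    rw [limSide_rayEdge]
    exact (Bool.eq_not.2 (S.joins_rayEdge ρ m).side_ne.symm).trans (Bool.eq_not.2 (hρ m).symm).symm
  · push Not at hray
    by_contra hne
    -- The ray heads for any vertex on the chosen side of `ε`, which is only finitely far away.
    obtain ⟨y, hy, -⟩ := ho ε ε
    have hmem : ∀ m, S.rayEdge ρ m ∈ S.sep (ρ.vert 0) y := fun m => by
      obtain ⟨ε', u, hj, hε', hsep⟩ := ho.exists_outgoing_edge
        (limSide_endpoint_eq_side hray m ▸ hne) hy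
      rw [ho.outgoing_edge_unique hj (S.joins_rayEdge ρ m) hε' (hρ m)] at hsep
      rwa [mem_sep, side_rayEdge_of_le ρ (Nat.zero_le m)]
    obtain ⟨t, ht⟩ := (eventually_rayEdge_notMem ρ (S.sep_finite (ρ.vert 0) y)).exists
    exact ht (hmem t)

theorem exists_limSide_eq [Nonempty V] (ho : S.Consistent o) :
    ∃ z : Completion G, ∀ ε, S.limSide ε z = o ε := by
  by_cases hx : ∃ x, ∀ ε, S.side ε x = o ε
  · obtain ⟨x, hx⟩ := hx
    exact ⟨.vertex x, by simpa using hx⟩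
  · push Not at hx
    obtain ⟨ρ, hρ⟩ := ho.exists_ray hx
    exact ⟨ρ.endpoint, ho.limSide_endpoint hρ⟩

end Consistent

/-! ### Half-trees at an end -/

variable (S) in
/-- The half-tree cut off by the `t`-th edge of a tight ray that contains the end of the ray. -/
def shadow (ρ : TightRay G) (t : ℕ) : Set V :=
  {x | S.side (S.rayEdge ρ t) x = S.side (S.rayEdge ρ t) (ρ.vert (t + 1))}

theorem side_rayEdge_eq_iff {t : ℕ} {x y : V} :
    S.side (S.rayEdge ρ t) x = S.side (S.rayEdge ρ t) y ↔
      (x ∈ S.shadow ρ t ↔ y ∈ S.shadow ρ t) := by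
  simp only [shadow, Set.mem_ofPred_eq]
  cases S.side (S.rayEdge ρ t) x <;> cases S.side (S.rayEdge ρ t) y <;>
    cases S.side (S.rayEdge ρ t) (ρ.vert (t + 1)) <;> simp

theorem vert_mem_shadow_iff {t m : ℕ} : ρ.vert m ∈ S.shadow ρ t ↔ t < m := by
  refine ⟨fun h => not_le.1 fun hm => (S.joins_rayEdge ρ t).side_ne ?_, side_rayEdge_of_lt ρ⟩
  rw [← side_rayEdge_of_le ρ hm]
  exact h

theorem coboundary_shadow (ρ : TightRay G) (t : ℕ) :
    S.coboundary (S.shadow ρ t) = {S.rayEdge ρ t} :=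
  S.coboundary_side _ _

theorem eventually_notMem_shadow (ρ : TightRay G) (x : V) : ∀ᶠ t in atTop, x ∉ S.shadow ρ t := by
  filter_upwards [eventually_rayEdge_notMem (S := S) ρ (S.sep_finite (ρ.vert 0) x)] with t ht hx
  exact absurd (vert_mem_shadow_iff.1 ((notMem_sep.1 ht).trans hx)) (Nat.not_lt_zero t)

theorem shadow_antitone (ρ : TightRay G) : Antitone (S.shadow ρ) := by
  refine antitone_nat_of_succ_le fun t x hx => ?_
  by_contra hxt
  have hsep : S.rayEdge ρ t ∈ S.sep x (ρ.vert (t + 2)) := by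
    rwa [mem_sep, side_rayEdge_of_lt ρ (show t < t + 2 by omega)]
  have hside := (S.joins_rayEdge ρ t).side_eq_of_mem_sep hsep (e := S.rayEdge ρ (t + 1))
    (notMem_sep.2 hx)
  exact absurd (vert_mem_shadow_iff.1 (hside.trans hx)) (by omega)

theorem shadow_mem_near_iff {t : ℕ} :
    S.shadow ρ t ∈ z.near ↔ S.limSide (S.rayEdge ρ t) z = S.limSide (S.rayEdge ρ t) ρ.endpoint := by
  rw [limSide_rayEdge, limSide_eq_iff]
  rfl

theorem eventually_limSide_eq_of_shadow_mem_near (ρ : TightRay G) (ε : E) :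
    ∀ᶠ t in atTop, ∀ z : Completion G, S.shadow ρ t ∈ z.near →
      S.limSide ε z = S.limSide ε ρ.endpoint := by
  filter_upwards [eventually_notMem_shadow (S := S) ρ (S.src ε)] with t ht z hz
  by_contra hne
  have hside := (S.joins_src_tgt ε).side_eq_of_limSide_ne hne (shadow_mem_near_iff.1 hz)
  exact ht (hside.trans ((shadow_mem_near_iff.1 hz).trans (limSide_rayEdge ρ t)))

theorem eventually_mem_of_shadow_mem_near {ρ : TightRay G} {W : Set (Completion G)}
    (hW : W ∈ 𝓝 ρ.endpoint) (S : SidedTree G E) :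
    ∀ᶠ t in atTop, ∀ z : Completion G, S.shadow ρ t ∈ z.near → z ∈ W := by
  obtain ⟨Q, hQ, hsub⟩ := (S.hasBasis_nhds ρ.endpoint).mem_iff.1 hW
  filter_upwards [(eventually_all_finite hQ).2 fun ε _ =>
    eventually_limSide_eq_of_shadow_mem_near (S := S) ρ ε] with t ht z hz
  exact hsub fun ε hε => ht ε hε z hz

theorem isOpen_shadow_mem_near (ρ : TightRay G) (t : ℕ) :
    IsOpen {z : Completion G | S.shadow ρ t ∈ z.near} := by
  simp only [shadow_mem_near_iff]
  exact S.isOpen_limSide_eq _ _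

theorem tendsto_nhds_endpoint {α : Type*} {l : Filter α} {g : α → Completion G}
    (h : ∀ t, ∀ᶠ a in l, S.shadow ρ t ∈ (g a).near) : Tendsto g l (𝓝 ρ.endpoint) := by
  refine S.tendsto_nhds_iff.2 fun ε => ?_
  obtain ⟨t, ht⟩ := (eventually_limSide_eq_of_shadow_mem_near (S := S) ρ ε).exists
  filter_upwards [h t] with a ha
  exact ht _ ha

end SidedTree

/-! ### The Bass–Serre tree as a sided tree -/

section BassSerre

variable {F : Type u} [Group F] {n k : ℕ} {A : Fin n → Subgroup F} {s : Fin k → F}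

namespace IsFreeProductDecomposition

theorem exists_hom (hF : IsFreeProductDecomposition A s) {K : Type*} [Group K]
    (φ : ∀ i, A i →* K) (t : Fin k → K) :
    ∃ ψ : F →* K, (∀ i (a : A i), ψ a = φ i a) ∧ ∀ j, ψ (s j) = t j := by
  let π := Monoid.Coprod.lift (Monoid.CoprodI.lift fun i => (A i).subtype) (FreeGroup.lift s)
  let e := MulEquiv.ofBijective π hF
  refine ⟨(Monoid.Coprod.lift (Monoid.CoprodI.lift φ) (FreeGroup.lift t)).comp e.symm.toMonoidHom,
    fun i a => ?_, fun j => ?_⟩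
  · have ha : e.symm a = Monoid.Coprod.inl (Monoid.CoprodI.of (M := fun i => A i) a) :=
      e.symm_apply_eq.2 (show (a : F) = π (.inl (.of a)) by simp [π])
    simp [ha]
  · have hj : e.symm (s j) = Monoid.Coprod.inr (FreeGroup.of j) :=
      e.symm_apply_eq.2 (show s j = π (.inr (.of j)) by simp [π])
    simp [hj]

theorem eq_top (hF : IsFreeProductDecomposition A s) {K : Subgroup F} (hA : ∀ i, A i ≤ K)
    (hs : ∀ j, s j ∈ K) : K = ⊤ := by
  refine eq_top_iff.2 ((MonoidHom.range_eq_top.2 hF.2).ge.trans ?_)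
  rw [Monoid.Coprod.range_lift, sup_le_iff]
  exact ⟨Monoid.CoprodI.lift_range_le _ _ fun i => (A i).range_subtype.trans_le (hA i),
    FreeGroup.range_lift_le (Set.range_subset_iff.2 hs)⟩

end IsFreeProductDecomposition

/-- The edges of the Bass–Serre tree: `⟨g, i⟩` joins `g.⋆` to `g A i`, and `⟨g, j⟩` joins `g.⋆` to
`g s_j.⋆`. -/
@[ext]
structure TreeEdge (F : Type u) (n k : ℕ) : Type u where
  /-- the element `g` for which the edge starts at `g.⋆` -/
  base : F
  /-- the prickle or petal of the thistle that lifts to the edge -/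
  label : Fin n ⊕ Fin k

namespace TreeEdge

instance : MulAction F (TreeEdge F n k) where
  smul c ε := ⟨c * ε.base, ε.label⟩
  one_smul ε := TreeEdge.ext (one_mul ε.base) rfl
  mul_smul c d ε := TreeEdge.ext (mul_assoc c d ε.base) rfl

@[simp] theorem smul_base (c : F) (ε : TreeEdge F n k) : (c • ε).base = c * ε.base := rfl

theorem base_smul_one (ε : TreeEdge F n k) : ε.base • (⟨1, ε.label⟩ : TreeEdge F n k) = ε :=
  TreeEdge.ext (mul_one _) rfl

theorem smul_left_injective (ε : TreeEdge F n k) : Function.Injective fun c : F => c • ε :=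
  fun _ _ h => mul_right_cancel (congrArg base h)

/-- The terminal vertex of an edge of the Bass–Serre tree. -/
def target (A : Fin n → Subgroup F) (s : Fin k → F) : TreeEdge F n k → TreeVertex A
  | ⟨g, .inl i⟩ => .inr ⟨i, g⟩
  | ⟨g, .inr j⟩ => .inl (g * s j)

theorem target_smul (c : F) (ε : TreeEdge F n k) : (c • ε).target A s = c • ε.target A s := by
  rcases ε with ⟨g, i | j⟩
  · rfl
  · exact congrArg Sum.inl (mul_assoc c g (s j))

end TreeEdge

theorem smul_inl (c g : F) : c • (Sum.inl g : TreeVertex A) = .inl (c * g) := rfl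

/-- The restriction of `θ` to `F` is a crossed homomorphism, that is, a homomorphism `F → N ⋊ F`,
which may be prescribed on the factors. Embedding `A i` into `N ⋊ F` through a conjugate puts the
increment on the edge to `A i`. -/
theorem IsFreeProductDecomposition.exists_cocycle (hF : IsFreeProductDecomposition A s)
    {N : Type*} [Group N] (φ : F →* MulAut N) (d : Fin n ⊕ Fin k → N) :
    ∃ θ : TreeVertex A → N, (∀ c x, θ (c • x) = θ (.inl c) * φ c (θ x)) ∧
      ∀ ε : TreeEdge F n k, θ (ε.target A s) = θ (.inl ε.base) * φ ε.base (d ε.label) := by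
  let e : Fin n → N ⋊[φ] F := fun i => SemidirectProduct.inl (d (.inl i))
  obtain ⟨ψ, hψA, hψs⟩ := hF.exists_hom
    (fun i => (MulAut.conj (e i)).toMonoidHom.comp (SemidirectProduct.inr.comp (A i).subtype))
    (fun j => SemidirectProduct.inl (d (.inr j)) * SemidirectProduct.inr (s j))
  have hright : ∀ g, (ψ g).right = g := by
    have htop : (SemidirectProduct.rightHom.comp ψ).eqLocus (MonoidHom.id F) = ⊤ :=
      hF.eq_top
        (fun i a ha => show (ψ a).right = a by simp [hψA i ⟨a, ha⟩, e])
        (fun j => show (ψ (s j)).right = s j by simp [hψs])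
    exact fun g => htop.ge (Subgroup.mem_top g)
  have hcoset : ∀ i (g h : F), QuotientGroup.leftRel (A i) g h →
      (ψ g * e i).left = (ψ h * e i).left := fun i g h hgh => by
    have ha : ψ (g⁻¹ * h) * e i = e i * SemidirectProduct.inr (g⁻¹ * h) := by
      rw [hψA i ⟨g⁻¹ * h, QuotientGroup.leftRel_apply.1 hgh⟩]
      simp
    rw [← mul_inv_cancel_left g h, map_mul, mul_assoc, ha, ← mul_assoc]
    simp
  let θ : TreeVertex A → N := fun x => match x with
    | .inl g => (ψ g).left
    | .inr ⟨i, q⟩ => Quotient.liftOn' q (fun g => (ψ g * e i).left) (hcoset i)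
  refine ⟨θ, ?_, ?_⟩
  · rintro c (g | ⟨i, ⟨g⟩⟩)
    · change (ψ (c * g)).left = (ψ c).left * φ c (ψ g).left
      rw [map_mul, SemidirectProduct.mul_left, hright]
    · change (ψ (c * g) * e i).left = (ψ c).left * φ c (ψ g * e i).left
      rw [map_mul, mul_assoc, SemidirectProduct.mul_left, hright]
  · rintro ⟨g, i | j⟩
    · change (ψ g * e i).left = (ψ g).left * φ g (d (.inl i))
      simp [hright, e]
    · change (ψ (g * s j)).left = (ψ g).left * φ g (d (.inr j))
      simp [hψs, hright]

theorem bassSerreTree_adj_iff (hs : ∀ j, s j ≠ 1) (x y : TreeVertex A) :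
    (bassSerreTree A s).Adj x y ↔ ∃ ε : TreeEdge F n k,
      (.inl ε.base = x ∧ ε.target A s = y) ∨ (.inl ε.base = y ∧ ε.target A s = x) := by
  have hrel : ∀ x y : TreeVertex A,
      ((∃ (g : F) (i : Fin n), x = Sum.inl g ∧ y = Sum.inr ⟨i, (g : F ⧸ A i)⟩) ∨
        (∃ (g : F) (j : Fin k), x = Sum.inl g ∧ y = Sum.inl (g * s j))) ↔
      ∃ ε : TreeEdge F n k, .inl ε.base = x ∧ ε.target A s = y := by
    refine fun x y => ⟨?_, ?_⟩
    · rintro (⟨g, i, rfl, rfl⟩ | ⟨g, j, rfl, rfl⟩)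
      · exact ⟨⟨g, .inl i⟩, rfl, rfl⟩
      · exact ⟨⟨g, .inr j⟩, rfl, rfl⟩
    · rintro ⟨⟨g, i | j⟩, rfl, rfl⟩
      · exact Or.inl ⟨g, i, rfl, rfl⟩
      · exact Or.inr ⟨g, j, rfl, rfl⟩
  have hne : ∀ ε : TreeEdge F n k, .inl ε.base ≠ ε.target A s := by
    rintro ⟨g, i | j⟩
    · exact Sum.inl_ne_inr
    · exact fun h => hs j (left_eq_mul.1 (Sum.inl_injective h))
  rw [bassSerreTree, SimpleGraph.fromRel_adj, hrel, hrel, exists_or, and_iff_right_iff_imp]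
  rintro (⟨ε, rfl, rfl⟩ | ⟨ε, rfl, rfl⟩)
  · exact hne ε
  · exact (hne ε).symm

theorem bassSerreTree_preconnected (hF : IsFreeProductDecomposition A s) (hs : ∀ j, s j ≠ 1) :
    (bassSerreTree A s).Preconnected := by
  have hsmul : ∀ (c : F) {x y : TreeVertex A}, (bassSerreTree A s).Reachable x y →
      (bassSerreTree A s).Reachable (c • x) (c • y) := fun c _ _ h =>
    h.map (⟨(c • ·), bassSerreTree_adj_smul A s c⟩ : bassSerreTree A s →g bassSerreTree A s)
  have hedge : ∀ ε : TreeEdge F n k,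
      (bassSerreTree A s).Reachable (.inl ε.base) (ε.target A s) :=
    fun ε => ((bassSerreTree_adj_iff hs _ _).2 ⟨ε, Or.inl ⟨rfl, rfl⟩⟩).reachable
  let K : Subgroup F :=
    { carrier := {g | (bassSerreTree A s).Reachable (.inl 1) (.inl g)}
      one_mem' := SimpleGraph.Reachable.refl _
      mul_mem' := fun {a b} ha hb => ha.trans (by simpa using hsmul a hb)
      inv_mem' := fun {a} ha => by simpa using (hsmul a⁻¹ ha).symm }
  have hK : K = ⊤ := hF.eq_top
    (fun i a ha => by
      have hcoset : (⟨1, .inl i⟩ : TreeEdge F n k).target A s =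
          (⟨a, .inl i⟩ : TreeEdge F n k).target A s :=
        congrArg (fun q : F ⧸ A i => Sum.inr (⟨i, q⟩ : Σ i, F ⧸ A i))
          (QuotientGroup.eq.2 (by simpa using ha))
      exact (hedge ⟨1, .inl i⟩).trans (hcoset ▸ (hedge ⟨a, .inl i⟩).symm))
    (fun j => by
      change (bassSerreTree A s).Reachable (.inl 1) (.inl (s j))
      simpa [TreeEdge.target] using hedge ⟨1, .inr j⟩)
  have hinl : ∀ g : F, (bassSerreTree A s).Reachable (.inl 1) (.inl g) :=
    fun g => hK.ge (Subgroup.mem_top g)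
  have hall : ∀ x, (bassSerreTree A s).Reachable (.inl 1) x := by
    rintro (g | ⟨i, ⟨g⟩⟩)
    · exact hinl g
    · exact (hinl g).trans (hedge ⟨g, .inl i⟩)
  exact fun x y => (hall x).symm.trans (hall y)

/-- A choice of sides for the edges of the Bass–Serre tree that is invariant under `F`. -/
structure BassSerreSides (A : Fin n → Subgroup F) (s : Fin k → F) extends
    SidedTree (bassSerreTree A s) (TreeEdge F n k) where
  src_eq : ∀ ε, src ε = .inl ε.base
  tgt_eq : ∀ ε, tgt ε = ε.target A s
  side_smul_smul : ∀ (c : F) (ε : TreeEdge F n k) (x : TreeVertex A),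
    side (c • ε) (c • x) = side ε x

theorem IsFreeProductDecomposition.nonempty_sides (hF : IsFreeProductDecomposition A s) :
    Nonempty (BassSerreSides A s) := by
  classical
  -- The value of `θ` at a vertex counts, modulo two, how often a path to it crosses each edge.
  obtain ⟨θ, hsmul, htarget⟩ := hF.exists_cocycle
    (mulAutArrow (G := F) (A := TreeEdge F n k) (M := Multiplicative (ZMod 2)))
    (fun ι => Pi.mulSingle ⟨1, ι⟩ (.ofAdd 1))
  have hcross : ∀ ε ε' : TreeEdge F n k, θ (ε'.target A s) ε = θ (.inl ε'.base) ε ↔ ε ≠ ε' := by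
    intro ε ε'
    have hmove : ε'.base⁻¹ • ε = ⟨1, ε'.label⟩ ↔ ε = ε' := by
      rw [inv_smul_eq_iff, TreeEdge.base_smul_one]
    rw [htarget, Pi.mul_apply, mul_eq_left]
    change (Pi.mulSingle ⟨1, ε'.label⟩ (.ofAdd 1) : TreeEdge F n k → Multiplicative (ZMod 2))
      (ε'.base⁻¹ • ε) = 1 ↔ _
    simp [Pi.mulSingle_apply, hmove]
  have hs : ∀ j, s j ≠ 1 := fun j hj =>
    (hcross ⟨1, .inr j⟩ ⟨1, .inr j⟩).1 (by simp [TreeEdge.target, hj]) rfl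
  refine ⟨⟨⟨fun ε => .inl ε.base, TreeEdge.target A s,
    fun ε x => decide (θ x ε ≠ θ (.inl ε.base) ε), bassSerreTree_adj_iff hs, fun ε => by simp,
    fun ε => by simp [hcross], fun ε ε' hne => by rw [(hcross ε ε').2 hne],
    bassSerreTree_preconnected hF hs⟩, fun _ => rfl, fun _ => rfl, fun c ε x => ?_⟩⟩
  have hθ : ∀ x, θ (c • x) (c • ε) = θ (.inl c) (c • ε) * θ x ε := fun x => by
    rw [hsmul, Pi.mul_apply]
    change _ * θ x (c⁻¹ • c • ε) = _
    rw [inv_smul_smul]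
  change decide (θ (c • x) (c • ε) ≠ θ (c • .inl ε.base) (c • ε)) = _
  simp only [hθ, ne_eq, mul_right_inj]

namespace BassSerreSides

open SidedTree

variable {B : BassSerreSides A s} {c : F} {ε : TreeEdge F n k} {x y : TreeVertex A}

theorem side_smul (c : F) (ε : TreeEdge F n k) (x : TreeVertex A) :
    B.side ε (c • x) = B.side (c⁻¹ • ε) x := by
  rw [← B.side_smul_smul c (c⁻¹ • ε), smul_inv_smul]

theorem smul_mem_sep_smul_iff : c • ε ∈ B.sep (c • x) (c • y) ↔ ε ∈ B.sep x y := by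
  rw [mem_sep, mem_sep, B.side_smul_smul, B.side_smul_smul]

theorem mem_sep_smul_iff : ε ∈ B.sep (c • x) (c • y) ↔ c⁻¹ • ε ∈ B.sep x y := by
  rw [mem_sep, mem_sep, side_smul, side_smul]

theorem src_smul (c : F) (ε : TreeEdge F n k) : B.src (c • ε) = c • B.src ε := by
  rw [B.src_eq, B.src_eq, smul_inl, TreeEdge.smul_base]

theorem tgt_smul (c : F) (ε : TreeEdge F n k) : B.tgt (c • ε) = c • B.tgt ε := by
  rw [B.tgt_eq, B.tgt_eq, TreeEdge.target_smul]

theorem joins_smul (h : B.Joins ε x y) : B.Joins (c • ε) (c • x) (c • y) := by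
  rcases h with ⟨rfl, rfl⟩ | ⟨rfl, rfl⟩
  · exact Or.inl ⟨src_smul c ε, tgt_smul c ε⟩
  · exact Or.inr ⟨src_smul c ε, tgt_smul c ε⟩

end BassSerreSides

theorem near_translate (c : F) (z : Completion (bassSerreTree A s)) :
    (translate c z).near = map (c • ·) z.near := by
  induction z using Completion.induction <;> rfl

theorem BassSerreSides.limSide_translate {B : BassSerreSides A s} (c : F) (ε : TreeEdge F n k)
    (z : Completion (bassSerreTree A s)) : B.limSide ε (translate c z) = B.limSide (c⁻¹ • ε) z := by
  rw [SidedTree.limSide_eq_iff, near_translate, eventually_map]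
  simp only [side_smul]
  exact B.eventually_side _ z

end BassSerre

section BassSerre

variable {F : Type u} [Group F] {n k : ℕ} {A : Fin n → Subgroup F} {s : Fin k → F}

/-! ### The homeomorphism of the boundary induced by an automorphism -/

/-- The bijection `gH ↦ Φ(g)γK` of cosets, where `Φ` followed by conjugation by `γ⁻¹` takes `H` onto
`K`. -/
def cosetEquiv {H K : Subgroup F} (Φ : F ≃* F) (γ : F) (h : ∀ a, a ∈ H ↔ γ⁻¹ * Φ a * γ ∈ K) :
    F ⧸ H ≃ F ⧸ K :=
  Quotient.congr (Φ.toEquiv.trans (Equiv.mulRight γ)) fun a b => by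
    change QuotientGroup.leftRel H a b ↔ QuotientGroup.leftRel K (Φ a * γ) (Φ b * γ)
    rw [QuotientGroup.leftRel_apply, QuotientGroup.leftRel_apply, h]
    simp [mul_assoc]

/-- A permutation of the vertices of the Bass–Serre tree that is equivariant up to `Φ` and extends
`Φ`. -/
structure TwistedPerm (A : Fin n → Subgroup F) (Φ : F ≃* F) where
  /-- the permutation of the vertices -/
  toEquiv : TreeVertex A ≃ TreeVertex A
  map_smul : ∀ (c : F) (x : TreeVertex A), toEquiv (c • x) = Φ c • toEquiv x
  map_one : toEquiv (.inl 1) = .inl 1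

instance {Φ : F ≃* F} : CoeFun (TwistedPerm A Φ) fun _ => TreeVertex A → TreeVertex A :=
  ⟨fun f => f.toEquiv⟩

theorem PermutesFactors.nonempty_twistedPerm {Φ : F ≃* F} (hΦ : PermutesFactors A Φ) :
    Nonempty (TwistedPerm A Φ) := by
  obtain ⟨σ, h⟩ := hΦ
  choose γ hγ using h
  have hmem : ∀ i a, a ∈ A i ↔ (γ i)⁻¹ * Φ a * γ i ∈ A (σ i) := fun i a =>
    (Subgroup.mem_map_iff_mem Φ.injective).symm.trans (hγ i (Φ a))
  refine ⟨⟨Equiv.sumCongr Φ.toEquiv (Equiv.sigmaCongr σ fun i => cosetEquiv Φ (γ i) (hmem i)),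
    ?_, congrArg Sum.inl (map_one Φ)⟩⟩
  rintro c (g | ⟨i, ⟨g⟩⟩)
  · exact congrArg Sum.inl (map_mul Φ c g)
  · change Sum.inr ⟨σ i, ((Φ (c * g) * γ i : F) : F ⧸ A (σ i))⟩ =
      (Sum.inr ⟨σ i, ((Φ c * (Φ g * γ i) : F) : F ⧸ A (σ i))⟩ : TreeVertex A)
    rw [map_mul, mul_assoc]

namespace TwistedPerm

open SidedTree BassSerreSides

variable {Φ : F ≃* F} (f : TwistedPerm A Φ)

/-- The inverse permutation, which is equivariant up to the inverse automorphism. -/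
def symm : TwistedPerm A Φ.symm where
  toEquiv := f.toEquiv.symm
  map_smul c x := by
    rw [Equiv.symm_apply_eq, f.map_smul]
    simp
  map_one := by rw [Equiv.symm_apply_eq, f.map_one]

theorem map_inl (g : F) : f (.inl g) = .inl (Φ g) := by
  rw [← mul_one g, ← smul_inl, f.map_smul, f.map_one, smul_inl, mul_one, mul_one]

@[simp] theorem symm_apply_apply (x : TreeVertex A) : f.symm (f x) = x :=
  f.toEquiv.symm_apply_apply x

variable (B : BassSerreSides A s)

/-- The edges whose image under `f`, a geodesic, runs over `ε`. -/
def pullback (ε : TreeEdge F n k) : Set (TreeEdge F n k) :=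
  {ε' | ε ∈ B.sep (f (B.src ε')) (f (B.tgt ε'))}

theorem pullback_eq_coboundary (ε : TreeEdge F n k) (b : Bool) :
    f.pullback B ε = B.coboundary (f ⁻¹' {x | B.side ε x = b}) := by
  ext ε'
  simp only [pullback, coboundary, mem_sep, Set.mem_ofPred_eq, Set.mem_preimage]
  cases B.side ε (f (B.src ε')) <;> cases B.side ε (f (B.tgt ε')) <;> cases b <;> simp

/-- Bounded cancellation: up to the action of `F` there are only finitely many edges, so `f` maps
edges to geodesics of bounded length. -/
theorem exists_finite_forall_pullback : ∃ R : Set F, R.Finite ∧ ∀ ε ε', ε' ∈ f.pullback B ε →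
    (Φ ε'.base)⁻¹ * ε.base ∈ R := by
  refine ⟨⋃ ι : Fin n ⊕ Fin k,
    TreeEdge.base '' B.sep (f (B.src ⟨1, ι⟩)) (f (B.tgt ⟨1, ι⟩)),
    Set.finite_iUnion fun ι => (B.sep_finite _ _).image _, ?_⟩
  rintro ε ε' h
  refine Set.mem_iUnion.2 ⟨ε'.label, (Φ ε'.base)⁻¹ • ε, ?_, rfl⟩
  rwa [pullback, Set.mem_ofPred_eq, ← ε'.base_smul_one, src_smul, tgt_smul, f.map_smul,
    f.map_smul, mem_sep_smul_iff] at h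

variable {B f}

theorem pullback_finite (ε : TreeEdge F n k) : (f.pullback B ε).Finite := by
  obtain ⟨R, hR, h⟩ := f.exists_finite_forall_pullback B
  have hinj : Function.Injective fun ε' : TreeEdge F n k => ((Φ ε'.base)⁻¹ * ε.base, ε'.label) :=
    fun ε₁ ε₂ he => by
      simp only [Prod.mk.injEq, mul_left_inj, inv_inj] at he
      exact TreeEdge.ext (Φ.injective he.1) he.2
  refine ((hR.prod Set.finite_univ).preimage hinj.injOn).subset fun ε' hε' => ?_
  exact ⟨h ε ε' hε', Set.mem_univ _⟩

theorem coboundary_preimage_finite {C : Set (TreeVertex A)} (hC : (B.coboundary C).Finite) :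
    (B.coboundary (f ⁻¹' C)).Finite := by
  refine (hC.biUnion fun ε _ => pullback_finite (f := f) (B := B) ε).subset fun ε' hε' => ?_
  by_contra hnot
  exact hε' (mem_iff_mem_of_disjoint_coboundary (S := B.toSidedTree) (C := C) fun ε hε hs =>
    hnot (Set.mem_biUnion hε hs))

theorem coboundary_preimage_side_finite (ε : TreeEdge F n k) (b : Bool) :
    (B.coboundary (f ⁻¹' {x | B.side ε x = b})).Finite :=
  f.pullback_eq_coboundary B ε b ▸ pullback_finite ε

variable (B f) in
theorem exists_limSide_map (z : Completion (bassSerreTree A s)) :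
    ∃ z' : Completion (bassSerreTree A s),
      ∀ ε, ∀ᶠ x in z.near, B.side ε (f x) = B.limSide ε z' := by
  have hconst : ∀ ε, ∃ b, ∀ᶠ x in z.near, B.side ε (f x) = b := fun ε => by
    rcases mem_near_or_compl_mem_near (coboundary_preimage_side_finite (f := f) (B := B) ε true) z
      with h | h
    · exact ⟨true, h⟩
    · exact ⟨false, mem_of_superset h fun x hx => by simpa using hx⟩
  choose o ho using hconst
  have hconsistent : B.Consistent o := fun e e' => by
    obtain ⟨x, hx, hx'⟩ := ((ho e).and (ho e')).exists
    exact ⟨f x, hx, hx'⟩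
  have : Nonempty (TreeVertex A) := ⟨.inl 1⟩
  obtain ⟨z', hz'⟩ := hconsistent.exists_limSide_eq
  exact ⟨z', fun ε => (hz' ε).symm ▸ ho ε⟩

variable (B f) in
/-- The extension of the permutation of the vertices to the completed tree. -/
noncomputable def extend (z : Completion (bassSerreTree A s)) : Completion (bassSerreTree A s) :=
  (f.exists_limSide_map B z).choose

theorem eventually_side_map (ε : TreeEdge F n k) (z : Completion (bassSerreTree A s)) :
    ∀ᶠ x in z.near, B.side ε (f x) = B.limSide ε (f.extend B z) :=
  (f.exists_limSide_map B z).choose_spec ε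

variable {ε : TreeEdge F n k} {z : Completion (bassSerreTree A s)}

theorem limSide_extend_iff {b : Bool} :
    B.limSide ε (f.extend B z) = b ↔ f ⁻¹' {x | B.side ε x = b} ∈ z.near := by
  refine ⟨fun h => h ▸ eventually_side_map ε z, fun h => ?_⟩
  obtain ⟨x, hx, hlim⟩ := (Filter.Eventually.and h (eventually_side_map (B := B) ε z)).exists
  exact hlim.symm.trans hx

theorem mem_near_extend {C : Set (TreeVertex A)} (hC : (B.coboundary C).Finite) :
    C ∈ (f.extend B z).near ↔ f ⁻¹' C ∈ z.near := by
  obtain ⟨x, hx, hxC⟩ : ∃ x, (∀ ε ∈ B.coboundary C, B.side ε (f x) = B.limSide ε (f.extend B z)) ∧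
      (f ⁻¹' C ∈ z.near ↔ f x ∈ C) := by
    have hside := (eventually_all_finite hC).2 fun ε _ => eventually_side_map (f := f) (B := B) ε z
    rcases mem_near_or_compl_mem_near (coboundary_preimage_finite (f := f) hC) z with h | h
    · obtain ⟨x, hx, hxC⟩ := (hside.and h).exists
      exact ⟨x, hx, iff_of_true h hxC⟩
    · obtain ⟨x, hx, hxC⟩ := (hside.and h).exists
      exact ⟨x, hx, iff_of_false (fun h' => (Filter.compl_notMem h') h) hxC⟩
  rw [hxC]
  exact ⟨mem_near_of_limSide_eq (z' := .vertex (f x)) hC fun ε hε => by simp [hx ε hε],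
    mem_near_of_limSide_eq (z := .vertex (f x)) hC fun ε hε => by simp [hx ε hε]⟩

theorem extend_vertex (x : TreeVertex A) :
    f.extend B (.vertex x) = (.vertex (f x) : Completion (bassSerreTree A s)) :=
  B.ext_limSide fun ε => by
    rw [limSide_vertex, limSide_extend_iff]
    exact mem_pure.2 rfl

theorem continuous_extend : Continuous (f.extend B) := by
  refine continuous_iff_continuousAt.2 fun z => B.tendsto_nhds_iff.2 fun ε => ?_
  have hC := coboundary_preimage_side_finite (f := f) (B := B) ε (B.limSide ε (f.extend B z))
  filter_upwards [(eventually_all_finite hC).2 fun e _ => B.eventually_limSide_eq e z] with z' hz'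
  exact limSide_extend_iff.2 (mem_near_of_limSide_eq hC (fun e he => (hz' e he).symm)
    (limSide_extend_iff.1 rfl))

theorem symm_extend_extend (z : Completion (bassSerreTree A s)) :
    f.symm.extend B (f.extend B z) = z := by
  refine B.ext_limSide fun ε => ?_
  rw [limSide_extend_iff, mem_near_extend (coboundary_preimage_side_finite ε _),
    ← Set.preimage_comp]
  filter_upwards [B.eventually_side ε z] with x hx
  simpa using hx

theorem extend_symm_extend (z : Completion (bassSerreTree A s)) :
    f.extend B (f.symm.extend B z) = z :=
  symm_extend_extend (f := f.symm) z

theorem extend_translate (c : F) (z : Completion (bassSerreTree A s)) :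
    f.extend B (translate c z) = translate (Φ c) (f.extend B z) := by
  refine B.ext_limSide fun ε => ?_
  rw [limSide_extend_iff, near_translate, mem_map]
  filter_upwards [eventually_side_map (f := f) (B := B) ((Φ c)⁻¹ • ε) z] with x hx
  simp only [Set.mem_preimage, Set.mem_ofPred_eq]
  rw [f.map_smul, side_smul, hx, limSide_translate]

theorem isBoundaryPoint_extend (hz : IsBoundaryPoint z) : IsBoundaryPoint (f.extend B z) := by
  cases z with
  | vertex x =>
    rw [extend_vertex]
    have : Infinite (MulAction.stabilizer F x) := hz
    have hstab : ∀ c : MulAction.stabilizer F x, Φ c ∈ MulAction.stabilizer F (f x) := fun c => by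
      rw [MulAction.mem_stabilizer_iff, ← f.map_smul, MulAction.mem_stabilizer_iff.1 c.2]
    change Infinite (MulAction.stabilizer F (f x))
    exact Infinite.of_injective (fun c : MulAction.stabilizer F x =>
      (⟨Φ c, hstab c⟩ : MulAction.stabilizer F (f x))) fun c d h =>
        Subtype.ext (Φ.injective (congrArg Subtype.val h))
  | atInfinity e =>
    cases h : f.extend B (.atInfinity e) with
    | vertex y =>
      have he := symm_extend_extend (f := f) (B := B) (.atInfinity e)
      rw [h, extend_vertex] at he
      cases he
    | atInfinity e' => trivial

variable (B f) in
/-- The homeomorphism of the boundary induced by the automorphism. -/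
noncomputable def boundaryHomeo : Boundary A s ≃ₜ Boundary A s where
  toFun ξ := ⟨f.extend B ξ.1, isBoundaryPoint_extend ξ.2⟩
  invFun ξ := ⟨f.symm.extend B ξ.1, isBoundaryPoint_extend ξ.2⟩
  left_inv ξ := Subtype.ext (symm_extend_extend ξ.1)
  right_inv ξ := Subtype.ext (extend_symm_extend ξ.1)
  continuous_toFun := (continuous_extend.comp continuous_subtype_val).subtype_mk _
  continuous_invFun := (continuous_extend.comp continuous_subtype_val).subtype_mk _

theorem boundaryHomeo_symm : (f.boundaryHomeo B).symm = f.symm.boundaryHomeo B := rfl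

theorem boundaryHomeo_apply (ξ : Boundary A s) : (f.boundaryHomeo B ξ).1 = f.extend B ξ.1 := rfl

theorem isBoundaryExtension_boundaryHomeo : IsBoundaryExtension A s Φ (f.boundaryHomeo B) := by
  intro ξ
  have h : (fun g => orbitPoint A s (Φ g)) = f.extend B ∘ orbitPoint A s := by
    funext g
    simp only [Function.comp_apply, orbitPoint, extend_vertex, map_inl]
  rw [h]
  exact (continuous_extend.tendsto ξ.1).comp tendsto_comap

end TwistedPerm

/-! ### Density of the orbit of the base vertex near the boundary -/

section

open SidedTree

theorem exists_inl_side_eq_of_infinite_stabilizer (B : BassSerreSides A s) {x : TreeVertex A}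
    (hx : Infinite (MulAction.stabilizer F x)) {Q : Set (TreeEdge F n k)} (hQ : Q.Finite) :
    ∃ g : F, ∀ ε ∈ Q, B.side ε (.inl g) = B.side ε x := by
  rcases x with g | ⟨i, ⟨y⟩⟩
  · exact ⟨g, fun _ _ => rfl⟩
  have hinj : Function.Injective fun c : MulAction.stabilizer F
      (Sum.inr ⟨i, (y : F ⧸ A i)⟩ : TreeVertex A) => c.1 • (⟨y, .inl i⟩ : TreeEdge F n k) :=
    (TreeEdge.smul_left_injective _).comp Subtype.val_injective
  have : Infinite (MulAction.stabilizer F (Sum.inr ⟨i, (y : F ⧸ A i)⟩ : TreeVertex A)) := hx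
  obtain ⟨c, hc⟩ := (hQ.preimage hinj.injOn).infinite_compl.nonempty
  have hj : B.Joins (c.1 • ⟨y, .inl i⟩) (.inl (c.1 * y)) (.inr ⟨i, (y : F ⧸ A i)⟩) :=
    Or.inl ⟨B.src_eq _, (B.tgt_eq _).trans (MulAction.mem_stabilizer_iff.1 c.2)⟩
  exact ⟨c.1 * y, fun ε hε => hj.side_eq fun h => hc (Set.mem_preimage.2 (h ▸ hε))⟩

theorem exists_inl_side_eq (B : BassSerreSides A s) (ξ : Boundary A s)
    {Q : Set (TreeEdge F n k)} (hQ : Q.Finite) :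
    ∃ g : F, ∀ ε ∈ Q, B.side ε (.inl g) = B.limSide ε ξ.1 := by
  obtain ⟨z, hz⟩ := ξ
  induction z using Completion.induction with
  | vertex x =>
    simp only [limSide_vertex]
    exact exists_inl_side_eq_of_infinite_stabilizer B hz hQ
  | endpoint ρ =>
    obtain ⟨N, hN⟩ := eventually_atTop.1 (B.eventually_forall_side ρ.endpoint hQ)
    refine ⟨(B.rayEdge ρ N).base, fun ε hε => ?_⟩
    -- One of the endpoints of every edge is in the orbit.
    rcases B.joins_rayEdge ρ N with ⟨h, -⟩ | ⟨h, -⟩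
    · rw [← B.src_eq, h, ← hN N le_rfl ε hε]
    · rw [← B.src_eq, h, ← hN (N + 1) N.le_succ ε hε]

theorem comap_orbitPoint_neBot (B : BassSerreSides A s) (ξ : Boundary A s) :
    (comap (orbitPoint A s) (𝓝 ξ.1)).NeBot := by
  refine comap_neBot fun U hU => ?_
  obtain ⟨Q, hQ, hsub⟩ := (B.hasBasis_nhds ξ.1).mem_iff.1 hU
  obtain ⟨g, hg⟩ := exists_inl_side_eq B ξ hQ
  exact ⟨g, hsub fun ε hε => (limSide_vertex ε _).trans (hg ε hε)⟩

theorem IsBoundaryExtension.unique (B : BassSerreSides A s) {Φ : F ≃* F}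
    {h h' : Boundary A s → Boundary A s}
    (hh : IsBoundaryExtension A s Φ h) (hh' : IsBoundaryExtension A s Φ h') : h = h' := by
  have := B.t2Space_completion
  funext ξ
  have := comap_orbitPoint_neBot B ξ
  exact Subtype.ext (tendsto_nhds_unique (hh ξ) (hh' ξ))

end

end BassSerre

/-! ### Elements without fixed vertices -/

namespace SidedTree

variable {V : Type v} {G : SimpleGraph V} {E : Type w} {S : SidedTree G E} {ε ε' : E}
  {v x p q p' q' : V}

theorem Joins.ncard_sep_lt (hj : S.Joins ε p q) (hε : ε ∈ S.sep v x)
    (hp : S.side ε p = S.side ε v) : (S.sep v p).ncard < (S.sep v x).ncard := by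
  refine Set.ncard_lt_ncard ⟨fun e he => ?_, fun hsub => hsub hε hp.symm⟩ (S.sep_finite _ _)
  by_contra hne
  exact he (hj.side_eq_of_mem_sep hε hne).symm

theorem eq_of_mem_sep_of_ncard_eq (hj : S.Joins ε p q) (hj' : S.Joins ε' p' q')
    (hε : ε ∈ S.sep v x) (hε' : ε' ∈ S.sep v x) (hp : S.side ε p = S.side ε v)
    (hp' : S.side ε' p' = S.side ε' v) (hcard : (S.sep v p).ncard = (S.sep v p').ncard) :
    ε = ε' := by
  by_contra hne
  have hvp : ε' ∉ S.sep v p := fun h => (hj'.ncard_sep_lt h hp').ne hcard.symm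
  have hqx' : ε' ∈ S.sep q x := by
    rwa [mem_sep, ← hj.side_eq (Ne.symm hne), ← notMem_sep.1 hvp]
  have hqx : ε ∉ S.sep q x := by
    intro h
    have hpq := hj.side_ne
    simp only [mem_sep, hp] at h hpq hε
    revert h hpq hε
    cases S.side ε v <;> cases S.side ε q <;> cases S.side ε x <;> simp
  have hvp' : ε ∈ S.sep v p' := by
    rw [mem_sep, hj'.side_eq_of_mem_sep hqx' hqx, ← hp]
    exact hj.side_ne
  exact (hj.ncard_sep_lt hvp' hp).ne hcard

end SidedTree

section Hyperbolic

open SidedTree BassSerreSides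

variable {F : Type u} [Group F] {n k : ℕ} {A : Fin n → Subgroup F} {s : Fin k → F}

theorem smul_inr_eq_iff {c g : F} {i : Fin n} :
    c • (.inr ⟨i, (g : F ⧸ A i)⟩ : TreeVertex A) = .inr ⟨i, (g : F ⧸ A i)⟩ ↔
      g⁻¹ * c * g ∈ A i := by
  have h : c • (.inr ⟨i, (g : F ⧸ A i)⟩ : TreeVertex A) = .inr ⟨i, ((c * g : F) : F ⧸ A i)⟩ := rfl
  rw [h, Sum.inr.injEq, Sigma.mk.injEq, heq_eq_eq, eq_comm (a := ((c * g : F) : F ⧸ A i)),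
    QuotientGroup.eq, mul_assoc]
  exact and_iff_right rfl

theorem forall_smul_ne_iff {c : F} :
    (∀ x : TreeVertex A, c • x ≠ x) ↔ c ≠ 1 ∧ ¬IsPeripheral A c := by
  refine ⟨fun h => ⟨?_, fun ⟨i, g, hg⟩ => h _ (smul_inr_eq_iff.2 hg)⟩, ?_⟩
  · rintro rfl
    exact h (.inl 1) (one_smul _ _)
  · rintro ⟨h1, h2⟩ (g | ⟨i, ⟨g⟩⟩) hx
    · rw [smul_inl] at hx
      exact h1 (by simpa using hx)
    · exact h2 ⟨i, g, smul_inr_eq_iff.1 hx⟩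

theorem TreeEdge.smul_ne {c : F} (hc : c ≠ 1) (ε : TreeEdge F n k) : c • ε ≠ ε := fun h =>
  hc (ε.smul_left_injective (h.trans (one_smul F ε).symm))

variable {B : BassSerreSides A s} {ε : TreeEdge F n k} {b : Bool} {c : F}

theorem eventually_side_pow_smul_eq (hc : Function.Injective fun m : ℕ => c ^ m)
    (p q : TreeVertex A) (ε : TreeEdge F n k) :
    ∀ᶠ m : ℕ in atTop, B.side ε (c ^ m • p) = B.side ε (c ^ m • q) := by
  have hinj : Function.Injective fun m : ℕ => (c ^ m)⁻¹ • ε := fun _ _ h =>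
    hc (inv_injective (ε.smul_left_injective h))
  rw [← Nat.cofinite_eq_atTop]
  filter_upwards [((B.sep_finite p q).preimage hinj.injOn).compl_mem_cofinite] with m hm
  by_contra h
  exact hm (mem_sep_smul_iff.1 h)

theorem translate_eq_of_eventually_side_pow_smul_eq {z : Completion (bassSerreTree A s)}
    (hz : ∀ p ε, ∀ᶠ m : ℕ in atTop, B.side ε (c ^ m • p) = B.limSide ε z) :
    translate c z = z := by
  refine B.ext_limSide fun ε => ?_
  obtain ⟨m, h, h'⟩ := ((hz (.inl 1) (c⁻¹ • ε)).and (hz (c • .inl 1) ε)).exists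
  rw [limSide_translate, ← h, ← h', ← side_smul, smul_smul, smul_smul, pow_mul_comm']

theorem exists_limSide_pow_smul (B : BassSerreSides A s)
    (hc : Function.Injective fun m : ℕ => c ^ m) :
    ∃ z : Completion (bassSerreTree A s), translate c z = z ∧
      ∀ p ε, ∀ᶠ m : ℕ in atTop, B.side ε (c ^ m • p) = B.limSide ε z := by
  have hconst : ∀ ε, ∃ b, ∀ᶠ m : ℕ in atTop, B.side ε (c ^ m • (.inl 1 : TreeVertex A)) = b := by
    intro ε
    obtain ⟨N, hN⟩ := eventually_atTop.1
      (eventually_side_pow_smul_eq (B := B) hc (.inl 1) (c • .inl 1) ε)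
    refine ⟨B.side ε (c ^ N • (.inl 1 : TreeVertex A)), eventually_atTop.2 ⟨N, fun m hm => ?_⟩⟩
    induction m, hm using Nat.le_induction with
    | base => rfl
    | succ m hm ih => rw [← ih, hN m hm, smul_smul, pow_succ]
  choose o ho using hconst
  have hconsistent : B.Consistent o := fun e e' => by
    obtain ⟨m, h, h'⟩ := ((ho e).and (ho e')).exists
    exact ⟨_, h, h'⟩
  have : Nonempty (TreeVertex A) := ⟨.inl 1⟩
  obtain ⟨z, hz⟩ := hconsistent.exists_limSide_eq
  have hlim : ∀ p ε, ∀ᶠ m : ℕ in atTop, B.side ε (c ^ m • p) = B.limSide ε z := fun p ε => by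
    filter_upwards [ho ε, eventually_side_pow_smul_eq (B := B) hc p (.inl 1) ε] with m h h'
    rw [h', h, hz]
  exact ⟨z, translate_eq_of_eventually_side_pow_smul_eq hlim, hlim⟩

/-- The nontrivial element `c` maps the half-tree on the side `b` of the edge `ε` into itself. -/
def Nests (B : BassSerreSides A s) (c : F) (ε : TreeEdge F n k) (b : Bool) : Prop :=
  c ≠ 1 ∧ ∀ x, B.side ε x = b → B.side ε (c • x) = b

namespace Nests

theorem pow (h : Nests B c ε b) (m : ℕ) {x : TreeVertex A} (hx : B.side ε x = b) :
    B.side ε (c ^ m • x) = b := by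
  induction m with
  | zero => simpa using hx
  | succ m ih =>
    rw [pow_succ', mul_smul]
    exact h.2 _ ih

theorem inv (h : Nests B c ε b) : Nests B c⁻¹ ε (!b) := by
  refine ⟨inv_ne_one.2 h.1, fun x hx => ?_⟩
  by_contra hne
  have hcx := h.2 (c⁻¹ • x) (by simpa using hne)
  rw [smul_inv_smul, hx] at hcx
  simp at hcx

theorem pow_ne_one (h : Nests B c ε b) {m : ℕ} (hm : m ≠ 0) : c ^ m ≠ 1 := by
  intro hpow
  obtain ⟨m, rfl⟩ := Nat.exists_eq_succ_of_ne_zero hm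
  -- A power being trivial, `c` maps the half-tree onto itself, so it fixes the edge.
  have hiff : ∀ x, B.side ε (c • x) = b ↔ B.side ε x = b := by
    refine fun x => ⟨fun hx => ?_, h.2 x⟩
    simpa [smul_smul, ← pow_succ, hpow] using h.pow m hx
  have heq : ∀ x, B.side (c⁻¹ • ε) x = B.side ε x := by
    intro x
    have hx := hiff x
    rw [side_smul] at hx
    revert hx
    cases B.side (c⁻¹ • ε) x <;> cases B.side ε x <;> cases b <;> simp
  refine TreeEdge.smul_ne (inv_ne_one.2 h.1) ε ((B.joins_src_tgt ε).mem_sep_iff.1 ?_)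
  rw [mem_sep, heq, heq]
  exact (B.joins_src_tgt ε).side_ne

theorem injective_pow (h : Nests B c ε b) : Function.Injective fun m : ℕ => c ^ m := by
  refine injective_pow_iff_not_isOfFinOrder.2 fun hfin => ?_
  obtain ⟨m, hm, hpow⟩ := isOfFinOrder_iff_pow_eq_one.1 hfin
  exact h.pow_ne_one hm.ne' hpow

theorem side_eq_of_smul_eq (h : Nests B c ε b) {x : TreeVertex A} (hx : c • x = x) :
    B.side ε x = b := by
  obtain ⟨p, -, -, hp⟩ := B.exists_joins_side_eq ε b
  obtain ⟨m, hm⟩ := (eventually_side_pow_smul_eq (B := B) h.injective_pow p x ε).exists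
  have hfix : c ^ m • x = x := (MulAction.stabilizer F x).pow_mem hx m
  rw [← h.pow m hp, hm, hfix]

theorem smul_ne (h : Nests B c ε b) (x : TreeVertex A) : c • x ≠ x := fun hx => by
  have hb := h.side_eq_of_smul_eq hx
  rw [h.inv.side_eq_of_smul_eq (inv_smul_eq_iff.2 hx.symm)] at hb
  simp at hb

theorem exists_axisEndpoint (h : Nests B c ε b) {H : Subgroup F} (hc : c ∈ H) :
    ∃ ξ ∈ axisEndpoints A s H, B.limSide ε ξ.1 = b := by
  obtain ⟨z, hz, hlim⟩ := exists_limSide_pow_smul B h.injective_pow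
  have hboundary : IsBoundaryPoint z := by
    rcases z with x | e
    · exact absurd (Completion.vertex.inj hz) (h.smul_ne x)
    · trivial
  obtain ⟨hc1, hcA⟩ := forall_smul_ne_iff.1 h.smul_ne
  refine ⟨⟨z, hboundary⟩, ⟨c, hc, hc1, hcA, hz⟩, ?_⟩
  obtain ⟨p, -, -, hp⟩ := B.exists_joins_side_eq ε b
  obtain ⟨m, hm⟩ := (hlim p ε).exists
  rw [← hm, h.pow m hp]

end Nests

theorem exists_nests (B : BassSerreSides A s) (hc : ∀ x : TreeVertex A, c • x ≠ x) :
    ∃ ε b, Nests B c ε b := by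
  have hc1 := (forall_smul_ne_iff.1 hc).1
  -- The first edge on the way from a vertex of minimal displacement to its image lies on the axis.
  have : Nonempty (TreeVertex A) := ⟨.inl 1⟩
  obtain ⟨p, hp⟩ : ∃ p, ∀ q, (B.sep p (c • p)).ncard ≤ (B.sep q (c • q)).ncard :=
    ⟨_, fun q => Function.argmin_le (fun p => (B.sep p (c • p)).ncard) q⟩
  obtain ⟨ε, u, hj, hε⟩ := B.exists_first_edge (hc p).symm
  have hcj : B.Joins (c • ε) (c • p) (c • u) := joins_smul hj
  have hcε : c • ε ∉ B.sep p (c • p) := by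
    intro hmem
    have hu : B.sep u (c • p) = B.sep p (c • p) \ {ε} := hj.sep_eq hε
    have hcu : B.sep (c • u) u = B.sep (c • p) u \ {c • ε} :=
      hcj.sep_eq (by rw [sep_comm, hu]; exact ⟨hmem, TreeEdge.smul_ne hc1 ε⟩)
    rw [sep_comm, sep_comm (c • p), hu] at hcu
    refine (hp u).not_gt (Set.ncard_lt_ncard ?_ (B.sep_finite _ _))
    rw [hcu]
    exact ⟨fun e he => he.1.1, fun hsub => (hsub hε).1.2 rfl⟩
  refine ⟨ε, B.side ε u, hc1, fun x hx => ?_⟩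
  by_contra hne
  have hcx : c • ε ∈ B.sep p (c • x) := by
    rw [mem_sep, notMem_sep.1 hcε, ← mem_sep, smul_mem_sep_smul_iff, mem_sep, hx]
    exact hj.side_ne
  have hεx : ε ∉ B.sep p (c • x) := by
    have hpu := hj.side_ne
    rw [notMem_sep]
    revert hpu hne
    cases B.side ε (c • x) <;> cases B.side ε u <;> cases B.side ε p <;> simp
  exact hε (hcj.side_eq_of_mem_sep hcx hεx).symm

theorem BassSerreSides.ncard_sep_smul (B : BassSerreSides A s) (c : F) (x y : TreeVertex A) :
    (B.sep (c • x) (c • y)).ncard = (B.sep x y).ncard := by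
  have h : B.sep (c • x) (c • y) = (c⁻¹ • ·) ⁻¹' B.sep x y := Set.ext fun _ => mem_sep_smul_iff
  rw [h, Set.ncard_preimage_of_injective_subset_range (MulAction.injective _)
    fun e _ => (MulAction.surjective c⁻¹) e]

theorem side_smul_eq_of_smul_eq {a : F} (ha : a ≠ 1) {v : TreeVertex A} (hv : a • v = v)
    {x : TreeVertex A} (hx : B.side ε x ≠ B.side ε v) : B.side ε (a • x) = B.side ε v := by
  by_contra hax
  have hv' : a⁻¹ • v = v := by rw [inv_smul_eq_iff, hv]
  obtain ⟨p, q, hj, hp⟩ := B.exists_joins_side_eq ε (B.side ε v)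
  have hside : B.side (a⁻¹ • ε) v = B.side ε v := by rw [← side_smul, hv]
  refine TreeEdge.smul_ne (inv_ne_one.2 ha) ε (eq_of_mem_sep_of_ncard_eq hj
    (joins_smul (c := a⁻¹) hj) (Ne.symm hx) ?_ hp ?_ ?_).symm
  · rw [mem_sep, hside, ← side_smul]
    exact Ne.symm hax
  · rw [hside, ← side_smul, smul_inv_smul, hp]
  · rw [← ncard_sep_smul B a⁻¹ v p, hv']

theorem exists_nests_mul (B : BassSerreSides A s) {a b : F} (ha : a ≠ 1) (hb : b ≠ 1)
    {v w : TreeVertex A} (hvw : v ≠ w) (hv : a • v = v) (hw : b • w = w) :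
    ∃ ε β, Nests B (a * b) ε β := by
  obtain ⟨ε, -, -, hε⟩ := B.exists_first_edge hvw
  have haw : B.side ε (a • w) = B.side ε v := side_smul_eq_of_smul_eq ha hv (Ne.symm hε)
  refine ⟨ε, B.side ε v, fun hab => hε ?_, fun x hx => ?_⟩
  · rw [← haw, ← hw, smul_smul, hab, one_smul, hw]
  · have hbx : B.side ε (b • x) = B.side ε w :=
      side_smul_eq_of_smul_eq hb hw (hx.trans_ne hε)
    rw [mul_smul]
    exact side_smul_eq_of_smul_eq ha hv (hbx.trans_ne (Ne.symm hε))

/-! ### Endpoints of axes -/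

theorem axisEndpoints_subset_boundaryInfty (H : Subgroup F) :
    axisEndpoints A s H ⊆ boundaryInfty A s := by
  rintro ⟨x | e, hb⟩ ⟨c, -, hc1, hcA, hc⟩
  · exact absurd (Completion.vertex.inj hc) (forall_smul_ne_iff.2 ⟨hc1, hcA⟩ x)
  · exact ⟨e, rfl⟩

theorem eventually_side_pow_smul_eq_limSide_endpoint {ρ : TightRay (bassSerreTree A s)} {m d : ℕ}
    (hd : 0 < d) (h : ∀ j, c • ρ.vert (m + j) = ρ.vert (m + d + j)) (p : TreeVertex A)
    (ε : TreeEdge F n k) :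
    ∀ᶠ q : ℕ in atTop, B.side ε (c ^ q • p) = B.limSide ε ρ.endpoint := by
  have hpow : ∀ q : ℕ, c ^ q • ρ.vert m = ρ.vert (m + q * d) := by
    intro q
    induction q with
    | zero => simp
    | succ q ih =>
      rw [pow_succ', mul_smul, ih, h]
      congr 1
      ring
  have hinj : Function.Injective fun q : ℕ => c ^ q := by
    intro a b hab
    have hvert : ρ.vert (m + a * d) = ρ.vert (m + b * d) := by
      rw [← hpow, ← hpow]
      exact congrArg (· • ρ.vert m) hab
    exact Nat.eq_of_mul_eq_mul_right hd (Nat.add_left_cancel (B.vert_injective ρ hvert))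
  have hray : ∀ᶠ j in atTop, B.side ε (ρ.vert j) = B.limSide ε ρ.endpoint :=
    limSide_endpoint_eq_iff.1 rfl
  have htop : Tendsto (fun q => m + q * d) atTop atTop :=
    tendsto_atTop_mono (fun q => (Nat.le_mul_of_pos_right q hd).trans (Nat.le_add_left _ _))
      tendsto_id
  filter_upwards [htop.eventually hray, eventually_side_pow_smul_eq (B := B) hinj p (ρ.vert m) ε]
    with q hq hq'
  rw [hq', hpow, hq]

theorem exists_pow_of_mem_axisEndpoints (B : BassSerreSides A s) {H : Subgroup F}
    {ξ : Boundary A s} (hξ : ξ ∈ axisEndpoints A s H) :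
    ∃ c ∈ H, (∀ x : TreeVertex A, c • x ≠ x) ∧
      ∀ p ε, ∀ᶠ m : ℕ in atTop, B.side ε (c ^ m • p) = B.limSide ε ξ.1 := by
  obtain ⟨e, he⟩ := axisEndpoints_subset_boundaryInfty H hξ
  obtain ⟨c, hcH, hc1, hcA, hc⟩ := hξ
  have hfix := forall_smul_ne_iff.2 ⟨hc1, hcA⟩
  rw [he] at hc ⊢
  induction e using Quotient.inductionOn with
  | _ ρ =>
    obtain ⟨m, m', h⟩ : ∃ m m', ∀ j, c • ρ.vert (m + j) = ρ.vert (m' + j) :=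
      Quotient.exact (Completion.atInfinity.inj hc)
    rcases lt_trichotomy m m' with hlt | rfl | hlt
    · obtain ⟨d, rfl⟩ := Nat.exists_eq_add_of_lt hlt
      exact ⟨c, hcH, hfix, eventually_side_pow_smul_eq_limSide_endpoint (d := d + 1) d.succ_pos h⟩
    · exact absurd (h 0) (hfix _)
    · obtain ⟨d, rfl⟩ := Nat.exists_eq_add_of_lt hlt
      exact ⟨c⁻¹, H.inv_mem hcH, fun x hx => hfix x (inv_smul_eq_iff.1 hx).symm,
        eventually_side_pow_smul_eq_limSide_endpoint (d := d + 1) d.succ_pos fun j =>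
          inv_smul_eq_iff.2 (h j).symm⟩

theorem translate_mul (a b : F) (z : Completion (bassSerreTree A s)) :
    translate (a * b) z = translate a (translate b z) := by
  induction z using Completion.induction with
  | vertex x => exact congrArg Completion.vertex (mul_smul a b x)
  | endpoint ρ =>
    have h : ρ.translate (a * b) = (ρ.translate b).translate a := by
      simp only [TightRay.translate, TightRay.mk.injEq]
      exact funext fun m => mul_smul a b _
    exact congrArg TightRay.endpoint h

theorem exists_mem_axisEndpoints_eq_translate {H : Subgroup F} {ξ : Boundary A s}
    (hξ : ξ ∈ axisEndpoints A s H) (hc : c ∈ H) :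
    ∃ ξ' ∈ axisEndpoints A s H, ξ'.1 = translate c ξ.1 := by
  obtain ⟨e, he⟩ := axisEndpoints_subset_boundaryInfty H hξ
  obtain ⟨d, hd, hd1, hdA, hdξ⟩ := hξ
  have hconj : ∀ x : TreeVertex A, (c * d * c⁻¹) • x ≠ x := fun x hx => by
    refine forall_smul_ne_iff.2 ⟨hd1, hdA⟩ (c⁻¹ • x) ?_
    rwa [mul_smul, mul_smul, ← eq_inv_smul_iff] at hx
  obtain ⟨hne, hper⟩ := forall_smul_ne_iff.1 hconj
  have hboundary : IsBoundaryPoint (translate c ξ.1) := by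
    rw [he]
    trivial
  refine ⟨⟨_, hboundary⟩, ⟨c * d * c⁻¹, H.mul_mem (H.mul_mem hc hd) (H.inv_mem hc), hne, hper, ?_⟩,
    rfl⟩
  rw [← translate_mul, inv_mul_cancel_right, translate_mul, hdξ]

theorem exists_axisEndpoints_limSide_ne (B : BassSerreSides A s) {H : Subgroup F} (hc : c ∈ H)
    (hfix : ∀ x : TreeVertex A, c • x ≠ x) :
    ∃ ε, ∃ a ∈ axisEndpoints A s H, ∃ b ∈ axisEndpoints A s H,
      B.limSide ε a.1 ≠ B.limSide ε b.1 := by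
  obtain ⟨ε, β, h⟩ := exists_nests B hfix
  obtain ⟨a, ha, haβ⟩ := h.exists_axisEndpoint hc
  obtain ⟨b, hb, hbβ⟩ := h.inv.exists_axisEndpoint (H.inv_mem hc)
  exact ⟨ε, a, ha, b, hb, by simp [haβ, hbβ]⟩

/-! ### The minimal subtree -/

/-- The vertices of the convex hull of a set `X` of boundary points: the endpoints of the edges
that separate two points of `X`. -/
def hull (B : BassSerreSides A s) (X : Set (Boundary A s)) : Set (TreeVertex A) :=
  {w | ∃ ε u, B.Joins ε w u ∧ ∃ a ∈ X, ∃ b ∈ X, B.limSide ε a.1 ≠ B.limSide ε b.1}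

variable {X : Set (Boundary A s)}

theorem exists_limSide_eq_side_of_mem_hull {w : TreeVertex A} (hw : w ∈ hull B X)
    (e : TreeEdge F n k) : ∃ a ∈ X, B.limSide e a.1 = B.side e w := by
  obtain ⟨ε, u, hj, a, ha, b, hb, hab⟩ := hw
  by_cases h : B.limSide e a.1 = B.limSide e b.1
  · exact ⟨a, ha, (hj.side_eq_of_limSide_ne hab h).symm⟩
  · by_cases h' : B.limSide e a.1 = B.side e w
    · exact ⟨a, ha, h'⟩
    · refine ⟨b, hb, ?_⟩
      revert h h'
      cases B.limSide e a.1 <;> cases B.limSide e b.1 <;> cases B.side e w <;> simp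

theorem induce_hull_connected (hX : (hull B X).Nonempty) :
    ((bassSerreTree A s).induce (hull B X)).Connected := by
  have hpre : ((bassSerreTree A s).induce (hull B X)).Preconnected := by
    rintro ⟨x, hx⟩ ⟨y, hy⟩
    induction x using B.geodesic_induction y with
    | base => exact .refl _
    | step x u ε hj hε _ ih =>
      obtain ⟨a, ha, hax⟩ := exists_limSide_eq_side_of_mem_hull hx ε
      obtain ⟨b, hb, hby⟩ := exists_limSide_eq_side_of_mem_hull hy ε
      have hu : u ∈ hull B X := ⟨ε, x, hj.symm, a, ha, b, hb, by rwa [hax, hby]⟩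
      exact (SimpleGraph.Adj.reachable (SimpleGraph.comap_adj.2 hj.adj)).trans (ih hu)
  have := hX.to_subtype
  exact ⟨hpre⟩

theorem smul_mem_hull_axisEndpoints {H : Subgroup F} (hc : c ∈ H) {x : TreeVertex A}
    (hx : x ∈ hull B (axisEndpoints A s H)) : c • x ∈ hull B (axisEndpoints A s H) := by
  obtain ⟨ε, u, hj, a, ha, b, hb, hab⟩ := hx
  obtain ⟨a', ha', haa'⟩ := exists_mem_axisEndpoints_eq_translate ha hc
  obtain ⟨b', hb', hbb'⟩ := exists_mem_axisEndpoints_eq_translate hb hc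
  refine ⟨c • ε, c • u, joins_smul hj, a', ha', b', hb', ?_⟩
  rwa [haa', hbb', limSide_translate, limSide_translate, inv_smul_smul]

theorem hull_axisEndpoints_nonempty {H : Subgroup F} (hE : (axisEndpoints A s H).Nonempty) :
    (hull B (axisEndpoints A s H)).Nonempty := by
  obtain ⟨ξ, hξ⟩ := hE
  obtain ⟨c, hc, hfix, -⟩ := exists_pow_of_mem_axisEndpoints B hξ
  obtain ⟨ε, hε⟩ := exists_axisEndpoints_limSide_ne B hc hfix
  exact ⟨B.src ε, ε, B.tgt ε, B.joins_src_tgt ε, hε⟩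

theorem hull_axisEndpoints_subset {H : Subgroup F} {Y : Set (TreeVertex A)}
    (hY : ((bassSerreTree A s).induce Y).Connected) (hinv : ∀ c ∈ H, ∀ x ∈ Y, c • x ∈ Y) :
    hull B (axisEndpoints A s H) ⊆ Y := by
  rintro w ⟨ε, u, hj, a, ha, b, hb, hab⟩
  by_contra hw
  obtain ⟨⟨p, hp⟩⟩ := hY.nonempty
  -- The orbit of `p` accumulates at `a` and at `b`, hence meets both sides of `ε`.
  obtain ⟨c, hc, -, hca⟩ := exists_pow_of_mem_axisEndpoints B ha
  obtain ⟨d, hd, -, hdb⟩ := exists_pow_of_mem_axisEndpoints B hb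
  obtain ⟨m, hm⟩ := (hca p ε).exists
  obtain ⟨m', hm'⟩ := (hdb p ε).exists
  obtain ⟨q⟩ := hY.preconnected ⟨_, hinv _ (H.pow_mem hc m) p hp⟩
    ⟨_, hinv _ (H.pow_mem hd m') p hp⟩
  have hq : w ∉ (q.map (SimpleGraph.Embedding.induce Y).toHom).support := by
    rw [SimpleGraph.Walk.support_map]
    intro h
    obtain ⟨⟨y, hy⟩, -, rfl⟩ := List.mem_map.1 h
    exact hw hy
  exact hab (hm.symm.trans ((hj.side_eq_of_walk _ hq).trans hm'))

theorem minimalSubtree_eq_hull {H : Subgroup F} (hE : (axisEndpoints A s H).Nonempty) :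
    minimalSubtree A s H = hull B (axisEndpoints A s H) :=
  Set.Subset.antisymm
    (Set.sInter_subset_of_mem ⟨induce_hull_connected (hull_axisEndpoints_nonempty hE),
      fun _ hc _ => smul_mem_hull_axisEndpoints hc⟩)
    (Set.subset_sInter fun _ hY => hull_axisEndpoints_subset hY.1 hY.2)

theorem exists_forall_smul_eq (B : BassSerreSides A s) {H : Subgroup F}
    (hE : axisEndpoints A s H = ∅) : ∃ v : TreeVertex A, ∀ c ∈ H, c • v = v := by
  have hfix : ∀ c ∈ H, ∃ x : TreeVertex A, c • x = x := by
    intro c hc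
    by_contra! h
    obtain ⟨ε, a, ha, -⟩ := exists_axisEndpoints_limSide_ne B hc h
    exact (hE ▸ ha : a ∈ (∅ : Set _))
  rcases H.bot_or_exists_ne_one with rfl | ⟨a, ha, ha1⟩
  · exact ⟨.inl 1, fun c hc => by rw [Subgroup.mem_bot.1 hc, one_smul]⟩
  obtain ⟨v, hv⟩ := hfix a ha
  refine ⟨v, fun b hb => ?_⟩
  rcases eq_or_ne b 1 with rfl | hb1
  · exact one_smul _ v
  obtain ⟨w, hw⟩ := hfix b hb
  rcases eq_or_ne v w with rfl | hvw
  · exact hw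
  obtain ⟨ε, β, h⟩ := exists_nests_mul B ha1 hb1 hvw hv hw
  obtain ⟨ξ, hξ, -⟩ := h.exists_axisEndpoint (H.mul_mem ha hb)
  exact (hE ▸ hξ : ξ ∈ (∅ : Set _)).elim

theorem minimalSubtree_subsingleton (B : BassSerreSides A s) {H : Subgroup F}
    (hE : axisEndpoints A s H = ∅) : (minimalSubtree A s H).Subsingleton := by
  obtain ⟨v, hv⟩ := exists_forall_smul_eq B hE
  have hconn : ((bassSerreTree A s).induce {v}).Connected := ⟨.of_subsingleton⟩
  have hsub : minimalSubtree A s H ⊆ {v} := Set.sInter_subset_of_mem ⟨hconn, fun c hc x hx => by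
    rw [Set.mem_singleton_iff.1 hx]
    exact hv c hc⟩
  exact Set.subsingleton_singleton.anti hsub

end Hyperbolic

/-! ### The boundary of a subgroup -/

theorem exists_infinite_fiber_of_mapsTo {α β : Type*} {Z : Set α} (hZ : Z.Infinite) {g : α → β}
    {R : Set β} (hg : Set.MapsTo g Z R) (hR : R.Finite) : ∃ r, (Z ∩ g ⁻¹' {r}).Infinite := by
  by_contra! h
  exact hZ (.of_finite_fibers g (hR.subset hg.image_subset) fun r _ => h r)

namespace SidedTree

variable {V : Type v} {E : Type w} {G : SimpleGraph V} {S : SidedTree G E} {z : Completion G}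
  {v : V} {e η : E}

variable (S) in
theorem consistent_limSide (z : Completion G) : S.Consistent fun ε => S.limSide ε z := by
  intro e e'
  obtain ⟨p, hp⟩ := (S.eventually_forall_side z (Set.toFinite {e, e'})).exists
  exact ⟨p, hp e (by simp), hp e' (by simp)⟩

theorem exists_joins_limSide_ne (S : SidedTree G E) (hz : z ≠ .vertex v) :
    ∃ η u, S.Joins η v u ∧ S.limSide η z ≠ S.side η v := by
  obtain ⟨ε, hε⟩ : ∃ ε, S.side ε v ≠ S.limSide ε z := by
    by_contra! h
    exact hz (S.ext_limSide fun ε => by rw [limSide_vertex, h])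
  obtain ⟨y, hy⟩ := (S.eventually_side ε z).exists
  obtain ⟨η, u, hj, hη, -⟩ := (S.consistent_limSide z).exists_outgoing_edge hε hy
  exact ⟨η, u, hj, hη.symm⟩

theorem Joins.mem_sep_of_limSide_ne {u q : V} (hj : S.Joins η v u)
    (hη : S.limSide η z ≠ S.side η v) (he : S.limSide e z ≠ S.side e v)
    (hq : S.side e q ≠ S.side e v) : η ∈ S.sep v q := by
  by_contra hs
  have hqz : S.limSide e (.vertex q) = S.limSide e z := by
    rw [limSide_vertex]
    revert hq he
    cases S.side e q <;> cases S.side e v <;> cases S.limSide e z <;> simp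
  have hv := hj.side_eq_of_limSide_ne (z := .vertex q) (z' := z)
    (by rwa [limSide_vertex, ← notMem_sep.1 hs, ne_comm]) hqz
  rw [limSide_vertex] at hv
  exact hq hv.symm

theorem eventually_shadow_notMem_near {ρ : TightRay G} (S : SidedTree G E)
    (hz : z ≠ ρ.endpoint) : ∀ᶠ t in atTop, S.shadow ρ t ∉ z.near := by
  obtain ⟨ε, hε⟩ : ∃ ε, S.limSide ε z ≠ S.limSide ε ρ.endpoint := by
    by_contra! h
    exact hz (S.ext_limSide h)
  filter_upwards [eventually_limSide_eq_of_shadow_mem_near (S := S) ρ ε] with t ht h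
  exact hε (ht z h)

end SidedTree

section SubgroupBoundary

open SidedTree BassSerreSides

variable {F : Type u} [Group F] {n k : ℕ} {A : Fin n → Subgroup F} {s : Fin k → F}
  {B : BassSerreSides A s} {X : Set (Boundary A s)} {ξ : Boundary A s} {v : TreeVertex A}
  {H : Subgroup F}

theorem exists_joins_limSide_ne_of_mem_boundaryInfty (B : BassSerreSides A s)
    (hξ : ξ ∈ boundaryInfty A s) (v : TreeVertex A) :
    ∃ η u, B.Joins η v u ∧ B.limSide η ξ.1 ≠ B.side η v := by
  obtain ⟨e, he⟩ := hξ
  refine B.exists_joins_limSide_ne fun h => ?_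
  rw [he] at h
  cases h

theorem mem_closure_iff_forall_limSide_eq (B : BassSerreSides A s) :
    ξ ∈ closure X ↔ ∀ Q : Set (TreeEdge F n k), Q.Finite →
      ∃ ζ ∈ X, ∀ ε ∈ Q, B.limSide ε ζ.1 = B.limSide ε ξ.1 := by
  have hbasis : (𝓝 ξ).HasBasis (fun Q : Set (TreeEdge F n k) => Q.Finite)
      (fun Q => Subtype.val ⁻¹' {z | ∀ ε ∈ Q, B.limSide ε z = B.limSide ε ξ.1}) := by
    rw [nhds_induced]
    exact (B.hasBasis_nhds ξ.1).comap _
  rw [mem_closure_iff_nhds_basis hbasis]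
  rfl

theorem mem_closure_iff_forall_shadow {ρ : TightRay (bassSerreTree A s)}
    (hξ : ξ.1 = ρ.endpoint) : ξ ∈ closure X ↔ ∀ t, ∃ ζ ∈ X, B.shadow ρ t ∈ ζ.1.near := by
  constructor
  · intro h t
    obtain ⟨ζ, hζ, hside⟩ := (mem_closure_iff_forall_limSide_eq B).1 h {B.rayEdge ρ t}
      (Set.finite_singleton _)
    refine ⟨ζ, hζ, ?_⟩
    rw [shadow_mem_near_iff, hside _ rfl, hξ]
  · intro h
    choose ζ hζ hs using h
    refine mem_closure_of_tendsto (f := ζ) (b := atTop) ?_ (.of_forall hζ)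
    rw [tendsto_subtype_rng, hξ]
    refine tendsto_nhds_endpoint (S := B.toSidedTree) fun t => ?_
    filter_upwards [eventually_ge_atTop t] with m hm
    exact mem_of_superset (hs m) (shadow_antitone ρ hm)

theorem exists_mem_axisEndpoints_ne (B : BassSerreSides A s)
    (hE : (axisEndpoints A s H).Nonempty) (z : Completion (bassSerreTree A s)) :
    ∃ a ∈ axisEndpoints A s H, a.1 ≠ z := by
  obtain ⟨ξ, hξ⟩ := hE
  obtain ⟨c, hc, hfix, -⟩ := exists_pow_of_mem_axisEndpoints B hξ
  obtain ⟨ε, a, ha, b, hb, hab⟩ := exists_axisEndpoints_limSide_ne B hc hfix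
  by_cases h : a.1 = z
  · exact ⟨b, hb, fun h' => hab (by rw [h, h'])⟩
  · exact ⟨a, ha, h⟩

theorem axisEndpoints_nonempty_of_forall_vert_mem (B : BassSerreSides A s)
    {ρ : TightRay (bassSerreTree A s)} (hρ : ∀ m, ρ.vert m ∈ minimalSubtree A s H) :
    (axisEndpoints A s H).Nonempty := by
  rw [Set.nonempty_iff_ne_empty]
  intro hE
  have hvert := minimalSubtree_subsingleton B hE (hρ 0) (hρ 1)
  exact absurd (B.vert_injective ρ hvert) (by decide)

theorem subgroupBoundary_inter_boundaryInfty (B : BassSerreSides A s) (H : Subgroup F) :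
    subgroupBoundary A s H ∩ boundaryInfty A s =
      closure (axisEndpoints A s H) ∩ boundaryInfty A s := by
  ext ξ
  refine and_congr_left ?_
  rintro ⟨e, he⟩
  obtain ⟨z, hb⟩ := ξ
  obtain rfl : z = .atInfinity e := he
  constructor
  · rintro ⟨ρ, rfl, hρ⟩
    have hE := axisEndpoints_nonempty_of_forall_vert_mem B hρ
    rw [minimalSubtree_eq_hull (B := B) hE] at hρ
    refine (mem_closure_iff_forall_shadow (B := B) rfl).2 fun t => ?_
    obtain ⟨a, ha, h⟩ := exists_limSide_eq_side_of_mem_hull (hρ (t + 1)) (B.rayEdge ρ t)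
    exact ⟨a, ha, by rw [shadow_mem_near_iff, h, limSide_rayEdge]⟩
  · intro hcl
    have hE : (axisEndpoints A s H).Nonempty := closure_nonempty_iff.1 ⟨_, hcl⟩
    induction e using Quotient.inductionOn with
    | _ ρ =>
      obtain ⟨a, ha, hane⟩ := exists_mem_axisEndpoints_ne B hE ρ.endpoint
      obtain ⟨T, hT⟩ := eventually_atTop.1 (B.eventually_shadow_notMem_near hane)
      refine ⟨⟨fun m => ρ.vert (T + m), fun m => ρ.adj (T + m), fun m => ρ.tight (T + m)⟩,
        Quotient.sound ⟨0, T, fun j => by simp⟩, fun m => ?_⟩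
      rw [minimalSubtree_eq_hull (B := B) hE]
      obtain ⟨b, hb, h⟩ := (mem_closure_iff_forall_shadow (B := B) rfl).1 hcl (T + m)
      refine ⟨B.rayEdge ρ (T + m), _, B.joins_rayEdge ρ (T + m), a, ha, b, hb, fun hab => ?_⟩
      refine hT (T + m) (by omega) ?_
      rw [shadow_mem_near_iff, hab, shadow_mem_near_iff.1 h]

theorem mem_closure_axisEndpoints_of_infinite_stabilizer (hξ : ξ.1 = .vertex v)
    (hE : (axisEndpoints A s H).Nonempty) (B : BassSerreSides A s)
    (hinf : (H ⊓ MulAction.stabilizer F v : Subgroup F).carrier.Infinite) :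
    ξ ∈ closure (axisEndpoints A s H) := by
  -- Infinitely many translates of an axis endpoint branch off at `v` in pairwise different edges.
  rw [mem_closure_iff_forall_limSide_eq B]
  intro Q hQ
  obtain ⟨a, ha⟩ := hE
  obtain ⟨η, u, hj, hη⟩ := exists_joins_limSide_ne_of_mem_boundaryInfty B
    (axisEndpoints_subset_boundaryInfty H ha) v
  have hfin : ((· • η) ⁻¹' ⋃ ε ∈ Q, (B.sep v (B.src ε) ∪ B.sep v (B.tgt ε)) : Set F).Finite :=
    (hQ.biUnion fun ε _ => (B.sep_finite _ _).union (B.sep_finite _ _)).preimage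
      η.smul_left_injective.injOn
  obtain ⟨c, hc, hcbad⟩ := (hinf.sdiff hfin).nonempty
  have hcv : c • v = v := MulAction.mem_stabilizer_iff.1 hc.2
  obtain ⟨a', ha', haa'⟩ := exists_mem_axisEndpoints_eq_translate ha hc.1
  refine ⟨a', ha', fun ε hε => ?_⟩
  by_contra hne
  rw [hξ, limSide_vertex] at hne
  have hj' : B.Joins (c • η) v (c • u) := by simpa [hcv] using joins_smul (c := c) hj
  have hη' : B.limSide (c • η) a'.1 ≠ B.side (c • η) v := by
    rwa [haa', limSide_translate, inv_smul_smul, ← hcv, side_smul, inv_smul_smul]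
  refine hcbad (Set.mem_biUnion hε ?_)
  by_cases h : B.side ε (B.src ε) = B.side ε v
  · exact .inr (hj'.mem_sep_of_limSide_ne hη' hne fun h' =>
      (B.joins_src_tgt ε).side_ne (h.trans h'.symm))
  · exact .inl (hj'.mem_sep_of_limSide_ne hη' hne h)

theorem mem_hull_of_mem_closure (hξ : ξ.1 = .vertex v) (hX : X ⊆ boundaryInfty A s)
    (hcl : ξ ∈ closure X) : v ∈ hull B X := by
  obtain ⟨a, ha⟩ := closure_nonempty_iff.1 ⟨ξ, hcl⟩
  obtain ⟨η, u, hj, hη⟩ := exists_joins_limSide_ne_of_mem_boundaryInfty B (hX ha) v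
  obtain ⟨b, hb, h⟩ := (mem_closure_iff_forall_limSide_eq B).1 hcl {η} (Set.finite_singleton η)
  refine ⟨η, u, hj, a, ha, b, hb, ?_⟩
  rwa [h η rfl, hξ, limSide_vertex]

theorem infinite_joins_limSide_ne (hξ : ξ.1 = .vertex v) (hX : X ⊆ boundaryInfty A s)
    (hcl : ξ ∈ closure X) :
    {η | (∃ u, B.Joins η v u) ∧ ∃ a ∈ X, B.limSide η a.1 ≠ B.side η v}.Infinite := by
  intro hfin
  obtain ⟨b, hb, h⟩ := (mem_closure_iff_forall_limSide_eq B).1 hcl _ hfin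
  obtain ⟨η, u, hj, hη⟩ := exists_joins_limSide_ne_of_mem_boundaryInfty B (hX hb) v
  have heq := h η ⟨⟨u, hj⟩, b, hb, hη⟩
  rw [hξ, limSide_vertex] at heq
  exact hη heq

end SubgroupBoundary

/-! ### The fixed subgroup of an automorphism -/

section FixedSubgroup

open SidedTree BassSerreSides TwistedPerm

variable {F : Type u} [Group F] {n k : ℕ} {A : Fin n → Subgroup F} {s : Fin k → F}
  {B : BassSerreSides A s} {Φ : F ≃* F} {f : TwistedPerm A Φ} {ε e : TreeEdge F n k}
  {x y w u : TreeVertex A}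

theorem fixedSubgroup_symm (Φ : F ≃* F) : fixedSubgroup Φ.symm = fixedSubgroup Φ :=
  Subgroup.ext fun _ => Φ.symm_apply_eq.trans eq_comm

theorem mul_inv_mem_fixedSubgroup {g h : F} (hgh : g⁻¹ * Φ g = h⁻¹ * Φ h) :
    g * h⁻¹ ∈ fixedSubgroup Φ := by
  change Φ (g * h⁻¹) = g * h⁻¹
  rw [map_mul, map_inv, inv_mul_eq_iff_eq_mul.1 hgh]
  group

theorem extend_eq_of_mem_axisEndpoints {ξ : Boundary A s}
    (hξ : ξ ∈ axisEndpoints A s (fixedSubgroup Φ)) : f.extend B ξ.1 = ξ.1 := by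
  have := B.t2Space_completion
  obtain ⟨c, hc, -, hside⟩ := exists_pow_of_mem_axisEndpoints B hξ
  have hlim : Tendsto (fun m : ℕ => (.vertex (c ^ m • .inl 1) : Completion (bassSerreTree A s)))
      atTop (𝓝 ξ.1) := B.tendsto_nhds_iff.2 fun ε => by simpa using hside (.inl 1) ε
  refine tendsto_nhds_unique (((continuous_extend (f := f) (B := B)).tendsto ξ.1).comp hlim) ?_
  convert hlim using 2 with m
  simp only [Function.comp_apply, extend_vertex, f.map_smul, f.map_one]
  rw [show Φ (c ^ m) = c ^ m from (fixedSubgroup Φ).pow_mem hc m]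

theorem closure_axisEndpoints_subset :
    closure (axisEndpoints A s (fixedSubgroup Φ)) ⊆ Function.fixedPoints (f.boundaryHomeo B) := by
  have := B.t2Space_completion
  exact closure_minimal (fun ξ hξ => Subtype.ext (extend_eq_of_mem_axisEndpoints hξ))
    (isClosed_fixedPoints (f.boundaryHomeo B).continuous)

namespace TwistedPerm

theorem smul_mem_pullback_smul_iff {c : F} {ε' : TreeEdge F n k} :
    c • ε' ∈ f.pullback B (Φ c • ε) ↔ ε' ∈ f.pullback B ε := by
  rw [pullback, Set.mem_ofPred_eq, src_smul, tgt_smul, f.map_smul, f.map_smul,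
    smul_mem_sep_smul_iff]
  rfl

variable (B f) in
/-- The endpoints of the edges whose image under `f` runs over `ε`. -/
def pullbackEnds (ε : TreeEdge F n k) : Set (TreeVertex A) :=
  {u | ∃ ε' ∈ f.pullback B ε, ∃ w, B.Joins ε' u w}

theorem exists_mem_pullbackEnds (h : B.side ε (f x) ≠ B.side ε (f y)) :
    ∃ a ∈ f.pullbackEnds B ε, ∀ e ∉ B.sep x y, B.side e a = B.side e x := by
  obtain ⟨ε', hsep, hε'⟩ := exists_mem_sep_mem_coboundary (S := B.toSidedTree)
    (C := f ⁻¹' {z | B.side ε z = B.side ε (f x)}) rfl h.symm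
  rw [← pullback_eq_coboundary] at hε'
  exact ⟨B.src ε', ⟨ε', hε', _, B.joins_src_tgt ε'⟩, fun e he =>
    (B.joins_src_tgt ε').side_eq_of_mem_sep hsep he⟩

theorem exists_mem_pullbackEnds_mem_sep (hj : B.Joins e w u) (he : e ∈ B.sep w y)
    (h : B.side ε (f w) ≠ B.side ε (f y)) : ∃ a ∈ f.pullbackEnds B ε, e ∈ B.sep w a := by
  by_cases hu : B.side ε (f w) = B.side ε (f u)
  · obtain ⟨a, ha, hside⟩ := exists_mem_pullbackEnds (hu ▸ h)
    refine ⟨a, ha, ?_⟩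
    rw [mem_sep, hside e (by simp [hj.sep_eq he])]
    exact hj.side_ne
  · have hmem : e ∈ f.pullback B ε := by
      rw [f.pullback_eq_coboundary B ε (B.side ε (f w)), hj.mem_coboundary_iff]
      simpa using Ne.symm hu
    exact ⟨u, ⟨e, hmem, w, hj.symm⟩, hj.side_ne⟩

variable (B f)

theorem exists_finite_pullbackEnds : ∃ U : Set (TreeVertex A), U.Finite ∧
    ∀ ε, ∀ u ∈ f.pullbackEnds B ε, (Φ.symm ε.base)⁻¹ • u ∈ U := by
  have hfin : (⋃ κ, f.pullback B ⟨1, κ⟩).Finite := Set.finite_iUnion fun κ => pullback_finite _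
  refine ⟨_, (hfin.image B.src).union (hfin.image B.tgt), ?_⟩
  rintro ε u ⟨ε', hε', w, hj⟩
  have hmem : (Φ.symm ε.base)⁻¹ • ε' ∈ ⋃ κ, f.pullback B ⟨1, κ⟩ := by
    refine Set.mem_iUnion.2 ⟨ε.label, ?_⟩
    rwa [← smul_mem_pullback_smul_iff (c := Φ.symm ε.base), smul_inv_smul, Φ.apply_symm_apply,
      ε.base_smul_one]
  rcases joins_smul (c := (Φ.symm ε.base)⁻¹) hj with ⟨h, -⟩ | ⟨-, h⟩
  · exact .inl ⟨_, hmem, h⟩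
  · exact .inr ⟨_, hmem, h⟩

theorem exists_finite_sep_pullbackEnds : ∃ P : Set F, P.Finite ∧ ∀ {ε w u}, B.Joins ε w u →
    ∀ a ∈ f.pullbackEnds B ε, ∀ η ∈ B.sep (f.symm w) a, (Φ.symm ε.base)⁻¹ * η.base ∈ P := by
  obtain ⟨U, hU, hUmem⟩ := f.exists_finite_pullbackEnds B
  let ends : Set (TreeVertex A) := Set.range fun κ => B.src ⟨1, κ⟩
  let ends' : Set (TreeVertex A) := Set.range fun κ => B.tgt ⟨1, κ⟩
  have hfin : (⋃ x ∈ ends ∪ ends', ⋃ u ∈ U, TreeEdge.base '' B.sep (f.symm x) u).Finite :=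
    ((Set.finite_range _).union (Set.finite_range _)).biUnion fun x _ =>
      hU.biUnion fun u _ => (B.sep_finite _ _).image _
  refine ⟨_, hfin, fun {ε w u} hj a ha η hη => ?_⟩
  have hw : ε.base⁻¹ • w ∈ ends ∪ ends' := by
    have hε : ε.base⁻¹ • ε = ⟨1, ε.label⟩ := by rw [inv_smul_eq_iff, ε.base_smul_one]
    rcases hj with ⟨rfl, -⟩ | ⟨-, rfl⟩
    · exact .inl ⟨ε.label, by rw [← src_smul, hε]⟩
    · exact .inr ⟨ε.label, by rw [← tgt_smul, hε]⟩
  refine Set.mem_biUnion hw (Set.mem_biUnion (hUmem ε a ha) ⟨(Φ.symm ε.base)⁻¹ • η, ?_, rfl⟩)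
  rwa [f.symm.map_smul, map_inv, smul_mem_sep_smul_iff]

end TwistedPerm

section Closure

variable {ξ : Boundary A s} {v : TreeVertex A}

theorem apply_eq_of_mem_closure_axisEndpoints (hξ : ξ.1 = .vertex v) (B : BassSerreSides A s)
    (f : TwistedPerm A Φ) (hcl : ξ ∈ closure (axisEndpoints A s (fixedSubgroup Φ))) :
    f v = v := by
  have h : f.extend B ξ.1 = ξ.1 :=
    congrArg Subtype.val (closure_axisEndpoints_subset (B := B) (f := f) hcl)
  rw [hξ, extend_vertex] at h
  exact Completion.vertex.inj h

theorem exists_mem_pullbackEnds_of_limSide_ne {a : Boundary A s}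
    (ha : a ∈ axisEndpoints A s (fixedSubgroup Φ)) (hv : f v = v) (hj : B.Joins e v u)
    (he : B.limSide e a.1 ≠ B.side e v) : ∃ p ∈ f.pullbackEnds B e, e ∈ B.sep v p := by
  have hf := eventually_side_map (f := f) (B := B) e a.1
  rw [extend_eq_of_mem_axisEndpoints ha] at hf
  obtain ⟨x, hfx, hx⟩ := (hf.and (B.eventually_side e a.1)).exists
  refine exists_mem_pullbackEnds_mem_sep hj (y := x) ?_ ?_
  · rw [mem_sep, hx]
    exact he.symm
  · rw [hv, hfx]
    exact he.symm

theorem smul_eq_of_joins {c : F} (hj : B.Joins ε v u) (hj' : B.Joins (c • ε) v w)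
    (hsrc : B.src ε = v ↔ B.src (c • ε) = v) : c • v = v := by
  by_cases h : B.src ε = v
  · rw [← h, ← src_smul, hsrc.1 h, h]
  · have htgt : B.tgt ε = v := hj.elim (fun h' => absurd h'.1 h) And.right
    have htgt' : B.tgt (c • ε) = v := hj'.elim (fun h' => absurd (hsrc.2 h'.1) h) And.right
    rw [← htgt, ← tgt_smul, htgt', htgt]

theorem infinite_stabilizer_of_mem_closure (hξ : ξ.1 = .vertex v) (B : BassSerreSides A s)
    (f : TwistedPerm A Φ) (hcl : ξ ∈ closure (axisEndpoints A s (fixedSubgroup Φ))) :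
    (fixedSubgroup Φ ⊓ MulAction.stabilizer F v : Subgroup F).carrier.Infinite := by
  have hv := apply_eq_of_mem_closure_axisEndpoints hξ B f hcl
  have hv' : f.symm v = v := by
    simpa [hv] using f.symm_apply_apply v
  have hZ := infinite_joins_limSide_ne (B := B) hξ (axisEndpoints_subset_boundaryInfty _) hcl
  obtain ⟨P, hP, hPmem⟩ := f.exists_finite_sep_pullbackEnds B
  -- Two edges at `v` in the same fiber differ by a fixed element that stabilizes `v`.
  let type (ε : TreeEdge F n k) : F × (Fin n ⊕ Fin k) × Prop :=
    ((Φ.symm ε.base)⁻¹ * ε.base, ε.label, B.src ε = v)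
  obtain ⟨r, hr⟩ := exists_infinite_fiber_of_mapsTo (R := P ×ˢ Set.univ) (g := type) hZ (by
    rintro ε ⟨⟨u, hj⟩, a, ha, hε⟩
    obtain ⟨p, hp, hsep⟩ := exists_mem_pullbackEnds_of_limSide_ne ha hv hj hε
    exact ⟨hPmem hj p hp ε (hv'.symm ▸ hsep), trivial⟩) (hP.prod Set.finite_univ)
  obtain ⟨ε₀, ⟨⟨u₀, hj₀⟩, -⟩, hε₀⟩ := hr.nonempty
  have hfiber : ∀ ε, type ε = r → (Φ.symm ε.base)⁻¹ * ε.base = (Φ.symm ε₀.base)⁻¹ * ε₀.base ∧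
      ε.label = ε₀.label ∧ (B.src ε = v ↔ B.src ε₀ = v) := fun ε hε => by
    simpa [type] using hε.trans (Eq.symm hε₀)
  refine (hr.image (f := fun ε => ε.base * ε₀.base⁻¹) fun ε hε ε' hε' h => ?_).mono ?_
  · exact TreeEdge.ext (mul_right_cancel h)
      ((hfiber ε hε.2).2.1.trans (hfiber ε' hε'.2).2.1.symm)
  rintro _ ⟨ε, ⟨⟨⟨u, hj⟩, -⟩, hε⟩, rfl⟩
  obtain ⟨hbase, hlabel, hsrc⟩ := hfiber ε hε
  have hsmul : (ε.base * ε₀.base⁻¹) • ε₀ = ε := TreeEdge.ext (by simp) hlabel.symm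
  refine ⟨?_, smul_eq_of_joins hj₀ (hsmul.symm ▸ hj) (hsmul.symm ▸ hsrc.symm)⟩
  rw [SetLike.mem_coe, ← fixedSubgroup_symm]
  refine mul_inv_mem_fixedSubgroup (inv_injective ?_)
  simpa using hbase

theorem subgroupBoundary_eq_closure (B : BassSerreSides A s) (f : TwistedPerm A Φ)
    (hE : (axisEndpoints A s (fixedSubgroup Φ)).Nonempty) :
    subgroupBoundary A s (fixedSubgroup Φ) = closure (axisEndpoints A s (fixedSubgroup Φ)) := by
  ext ⟨z, hz⟩
  cases z with
  | vertex v =>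
    change v ∈ minimalSubtree A s (fixedSubgroup Φ) ∧
      (fixedSubgroup Φ ⊓ MulAction.stabilizer F v : Subgroup F).carrier.Infinite ↔ _
    rw [minimalSubtree_eq_hull (B := B) hE]
    exact ⟨fun h => mem_closure_axisEndpoints_of_infinite_stabilizer rfl hE B h.2, fun h =>
      ⟨mem_hull_of_mem_closure rfl (axisEndpoints_subset_boundaryInfty _) h,
        infinite_stabilizer_of_mem_closure rfl B f h⟩⟩
  | atInfinity e =>
    have h := Set.ext_iff.1 (subgroupBoundary_inter_boundaryInfty B (fixedSubgroup Φ))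
      ⟨.atInfinity e, hz⟩
    have he : (⟨.atInfinity e, hz⟩ : Boundary A s) ∈ boundaryInfty A s := ⟨e, rfl⟩
    simpa [he] using h

end Closure

theorem isBoundaryPoint_translate {z : Completion (bassSerreTree A s)} (c : F)
    (hz : IsBoundaryPoint z) : IsBoundaryPoint (translate c z) := by
  cases z with
  | vertex x =>
    change Infinite (MulAction.stabilizer F (c • x))
    have : Infinite (MulAction.stabilizer F x) := hz
    exact Infinite.of_injective _ (MulAction.stabilizerEquivStabilizer rfl).injective
  | atInfinity e => trivial

theorem translate_injective (B : BassSerreSides A s) (c : F) : Function.Injective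
    (translate c : Completion (bassSerreTree A s) → Completion (bassSerreTree A s)) :=
  fun z z' h => B.ext_limSide fun ε => by
    simpa [limSide_translate] using congrArg (B.limSide (c • ε)) h

theorem translate_pow_eq (B : BassSerreSides A s) {c : F}
    {z : Completion (bassSerreTree A s)} (h : translate c z = z) (m : ℕ) :
    translate (c ^ m) z = z := by
  induction m with
  | zero => exact B.ext_limSide fun ε => by rw [pow_zero, limSide_translate, inv_one, one_smul]
  | succ m ih => rw [pow_succ, translate_mul, h, ih]

theorem eventually_limSide_translate_pow {c : F} {z ζ₁ ζ₂ : Completion (bassSerreTree A s)}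
    (hc : ∀ p ε, ∀ᶠ m : ℕ in atTop, B.side ε (c ^ m • p) = B.limSide ε z) (hne : ζ₁ ≠ ζ₂)
    (e : TreeEdge F n k) : ∀ᶠ m : ℕ in atTop, B.limSide e (translate (c ^ m) ζ₁) = B.limSide e z ∨
      B.limSide e (translate (c ^ m) ζ₂) = B.limSide e z := by
  obtain ⟨ε, hε⟩ : ∃ ε, B.limSide ε ζ₁ ≠ B.limSide ε ζ₂ := by
    by_contra! h
    exact hne (B.ext_limSide h)
  filter_upwards [hc (B.src ε) e] with m hm
  by_contra! h
  have hside := (joins_smul (B.joins_src_tgt ε)).side_eq_of_limSide_ne (ε := c ^ m • ε) (e := e)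
    (z := translate (c ^ m) ζ₁) (z' := translate (c ^ m) ζ₂)
    (by rwa [limSide_translate, limSide_translate, inv_smul_smul])
    ((Bool.eq_not.2 h.1).trans (Bool.eq_not.2 h.2).symm)
  exact h.1 (hside.symm.trans hm)

theorem exists_ne_ne_of_three_le_encard {α : Type*} {S : Set α} (h : 3 ≤ S.encard) (a : α) :
    ∃ b ∈ S, ∃ c ∈ S, b ≠ a ∧ c ≠ a ∧ b ≠ c := by
  have hlt : 1 < (S \ {a}).encard := by
    have hle := h.trans (Set.encard_le_encard_sdiff_add_encard S {a})
    rw [Set.encard_singleton] at hle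
    by_contra! h1
    exact absurd (hle.trans (add_le_add_left h1 1)) (by decide)
  obtain ⟨b, c, hb, hc, hbc⟩ := Set.one_lt_encard_iff.1 hlt
  exact ⟨b, hb.1, c, hc.1, hb.2, hc.2, hbc⟩

theorem not_isIsolatedIn_of_mem_axisEndpoints {ξ : Boundary A s}
    (h3 : 3 ≤ (Function.fixedPoints (f.boundaryHomeo B)).encard)
    (hξ : ξ ∈ axisEndpoints A s (fixedSubgroup Φ)) :
    ¬ IsIsolatedIn (Function.fixedPoints (f.boundaryHomeo B)) ξ := by
  -- If `ξ` is the sink of a fixed element `c`, then the powers of `c` take all fixed points but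
  -- one to fixed points close to `ξ`.
  rintro ⟨U, hU, hUξ⟩
  obtain ⟨ζ₁, hζ₁, ζ₂, hζ₂, hne₁, hne₂, hne⟩ := exists_ne_ne_of_three_le_encard h3 ξ
  obtain ⟨c, hcfix, -, hc⟩ := exists_pow_of_mem_axisEndpoints B hξ
  have hmove (m : ℕ) : ∀ ζ ∈ Function.fixedPoints (f.boundaryHomeo B), ζ ≠ ξ →
      ⟨translate (c ^ m) ζ.1, isBoundaryPoint_translate _ ζ.2⟩ ∉ U := by
    intro ζ hζ hne hmem
    have hfix : f.extend B (translate (c ^ m) ζ.1) = translate (c ^ m) ζ.1 := by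
      rw [extend_translate, show Φ (c ^ m) = c ^ m from (fixedSubgroup Φ).pow_mem hcfix m]
      exact congrArg _ (congrArg Subtype.val hζ)
    have hζξ := (Set.ext_iff.1 hUξ _).1 ⟨hmem, Subtype.ext hfix⟩
    refine hne (Subtype.ext (translate_injective B (c ^ m) ?_))
    rw [translate_pow_eq B (translate_eq_of_eventually_side_pow_smul_eq hc)]
    exact congrArg Subtype.val hζξ
  obtain ⟨W, hW, rfl⟩ := isOpen_induced_iff.1 hU
  obtain ⟨e, he⟩ := axisEndpoints_subset_boundaryInfty _ hξ
  induction e using Quotient.inductionOn with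
  | _ ρ =>
    have hξW : ξ ∈ Subtype.val ⁻¹' W := ((Set.ext_iff.1 hUξ ξ).2 rfl).1
    obtain ⟨t, ht⟩ := (eventually_mem_of_shadow_mem_near (ρ := ρ)
      (hW.mem_nhds (he ▸ hξW : (.atInfinity ⟦ρ⟧ : Completion _) ∈ W)) B.toSidedTree).exists
    have hnear : ∀ z, B.limSide (B.rayEdge ρ t) z = B.limSide (B.rayEdge ρ t) ξ.1 → z ∈ W :=
      fun z hz => ht z (by rw [shadow_mem_near_iff, hz, he])
    obtain ⟨m, hm | hm⟩ := (eventually_limSide_translate_pow hc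
      (fun h => hne (Subtype.ext h)) (B.rayEdge ρ t)).exists
    · exact hmove m ζ₁ hζ₁ hne₁ (hnear _ hm)
    · exact hmove m ζ₂ hζ₂ hne₂ (hnear _ hm)

theorem not_isIsolatedIn_of_mem_closure {ξ : Boundary A s}
    (h3 : 3 ≤ (Function.fixedPoints (f.boundaryHomeo B)).encard)
    (hξ : ξ ∈ closure (axisEndpoints A s (fixedSubgroup Φ))) :
    ¬ IsIsolatedIn (Function.fixedPoints (f.boundaryHomeo B)) ξ := by
  rintro ⟨U, hU, hUξ⟩
  have hξU : ξ ∈ U := ((Set.ext_iff.1 hUξ ξ).2 rfl).1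
  obtain ⟨ζ, hζU, hζ⟩ := mem_closure_iff.1 hξ U hU hξU
  obtain rfl : ζ = ξ := (Set.ext_iff.1 hUξ ζ).1
    ⟨hζU, closure_axisEndpoints_subset (subset_closure hζ)⟩
  exact not_isIsolatedIn_of_mem_axisEndpoints h3 hζ ⟨U, hU, hUξ⟩

end FixedSubgroup

/-! ### Dynamics at a fixed end -/

section Dynamics

open SidedTree BassSerreSides TwistedPerm
open scoped Pointwise

variable {F : Type u} [Group F] {n k : ℕ} {A : Fin n → Subgroup F} {s : Fin k → F}
  {B : BassSerreSides A s} {Φ : F ≃* F} {f : TwistedPerm A Φ} {ε e : TreeEdge F n k}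
  {u x y : TreeVertex A} {ρ : TightRay (bassSerreTree A s)} {t t' : ℕ} {ξ : Boundary A s}

theorem nests_of_smul_rayEdge {c : F} (htt' : t' < t) (hc : c • B.rayEdge ρ t' = B.rayEdge ρ t)
    (hside : B.side (B.rayEdge ρ t') (ρ.vert (t' + 1)) =
      B.side (B.rayEdge ρ t) (ρ.vert (t + 1))) :
    Nests B c (B.rayEdge ρ t') (B.side (B.rayEdge ρ t') (ρ.vert (t' + 1))) := by
  refine ⟨?_, fun x hx => shadow_antitone ρ htt'.le (a := t') (b := t) ?_⟩
  · rintro rfl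
    rw [one_smul] at hc
    exact htt'.ne (rayEdge_injective ρ hc)
  · change B.side _ _ = B.side _ _
    rw [← hside, ← hc, B.side_smul_smul, hx]

theorem eventually_displacement_notMem (hξ : ξ.1 = ρ.endpoint)
    (hcl : ξ ∉ closure (axisEndpoints A s (fixedSubgroup Φ))) {R : Set F} (hR : R.Finite) :
    ∀ᶠ t in atTop, (B.rayEdge ρ t).base⁻¹ * Φ (B.rayEdge ρ t).base ∉ R := by
  -- Of infinitely many edges displaced by elements of `R`, two are carried one to the other by a
  -- fixed element, whose axis then leaves the ray arbitrarily far out.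
  by_contra hfreq
  refine hcl ((mem_closure_iff_forall_shadow (B := B) hξ).2 fun t₀ => ?_)
  let type (t : ℕ) : F × (Fin n ⊕ Fin k) × Bool :=
    ((B.rayEdge ρ t).base⁻¹ * Φ (B.rayEdge ρ t).base, (B.rayEdge ρ t).label,
      B.side (B.rayEdge ρ t) (ρ.vert (t + 1)))
  obtain ⟨r, hr⟩ := exists_infinite_fiber_of_mapsTo (g := type) (R := R ×ˢ Set.univ)
    (Nat.frequently_atTop_iff_infinite.1 (not_eventually.1 hfreq))
    (fun t ht => ⟨not_not.1 ht, trivial⟩) (hR.prod Set.finite_univ)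
  obtain ⟨t', ⟨-, ht'⟩, htt₀⟩ := hr.exists_gt t₀
  obtain ⟨t, ⟨-, ht⟩, htt'⟩ := hr.exists_gt t'
  have htype : type t = type t' := ht.trans (Eq.symm ht')
  simp only [type, Prod.mk.injEq] at htype
  obtain ⟨hbase, hlabel, hside⟩ := htype
  have hc : ((B.rayEdge ρ t).base * (B.rayEdge ρ t').base⁻¹) • B.rayEdge ρ t' = B.rayEdge ρ t :=
    TreeEdge.ext (by simp) hlabel.symm
  obtain ⟨ζ, hζ, hζside⟩ := (nests_of_smul_rayEdge htt' hc hside.symm).exists_axisEndpoint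
    (mul_inv_mem_fixedSubgroup hbase)
  refine ⟨ζ, hζ, mem_of_superset ?_ (shadow_antitone ρ htt₀.le)⟩
  rw [shadow_mem_near_iff, hζside, limSide_rayEdge]

namespace TwistedPerm

variable (B f) in
/-- The edges of the convex hull of the endpoints of the edges whose image under `f` runs
over `ε`. -/
def pullbackHull (ε : TreeEdge F n k) : Set (TreeEdge F n k) :=
  {e | ∃ a ∈ f.pullbackEnds B ε, ∃ a' ∈ f.pullbackEnds B ε, e ∈ B.sep a a'}

theorem pullback_subset_pullbackHull : f.pullback B ε ⊆ f.pullbackHull B ε := fun e he =>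
  ⟨B.src e, ⟨e, he, _, B.joins_src_tgt e⟩, B.tgt e, ⟨e, he, _, (B.joins_src_tgt e).symm⟩,
    (B.joins_src_tgt e).side_ne⟩

variable (B f)

theorem exists_finite_pullbackHull : ∃ R : Set F, R.Finite ∧
    ∀ ε, ∀ e ∈ f.pullbackHull B ε, (Φ e.base)⁻¹ * ε.base ∈ R := by
  obtain ⟨U, hU, hUmem⟩ := f.exists_finite_pullbackEnds B
  have hfin : (⋃ a ∈ U, ⋃ a' ∈ U, TreeEdge.base '' B.sep a a').Finite :=
    hU.biUnion fun a _ => hU.biUnion fun a' _ => (B.sep_finite a a').image _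
  refine ⟨_, hfin.image fun g => (Φ g)⁻¹, ?_⟩
  rintro ε e ⟨a, ha, a', ha', he⟩
  refine ⟨(Φ.symm ε.base)⁻¹ * e.base, Set.mem_biUnion (hUmem ε a ha)
    (Set.mem_biUnion (hUmem ε a' ha') ⟨(Φ.symm ε.base)⁻¹ • e, smul_mem_sep_smul_iff.2 he, rfl⟩), ?_⟩
  simp

theorem exists_finite_common_sep : ∃ R : Set F, R.Finite ∧
    ∀ {e e' w u u'}, B.Joins e w u → B.Joins e' w u' →
      ∀ a ∈ f.pullbackEnds B e, ∀ a' ∈ f.pullbackEnds B e', ∀ η ∈ B.sep (f.symm w) a,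
        η ∈ B.sep (f.symm w) a' → e.base⁻¹ * e'.base ∈ R := by
  obtain ⟨P, hP, hPmem⟩ := f.exists_finite_sep_pullbackEnds B
  refine ⟨Set.image2 (fun g h => Φ (g * h⁻¹)) P P, hP.image2 _ hP, ?_⟩
  intro e e' w u u' hj hj' a ha a' ha' η hη hη'
  refine ⟨_, hPmem hj a ha η hη, _, hPmem hj' a' ha' η hη', ?_⟩
  simp

end TwistedPerm

theorem eventually_notMem_pullbackHull (B : BassSerreSides A s) (f : TwistedPerm A Φ)
    (hξ : ξ.1 = ρ.endpoint) (hcl : ξ ∉ closure (axisEndpoints A s (fixedSubgroup Φ))) :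
    ∀ᶠ t in atTop, B.rayEdge ρ t ∉ f.pullbackHull B (B.rayEdge ρ t) := by
  obtain ⟨R, hR, hRmem⟩ := f.exists_finite_pullbackHull B
  filter_upwards [eventually_displacement_notMem (B := B) hξ hcl hR.inv] with t ht hmem
  exact ht (by simpa using hRmem _ _ hmem)

theorem shadow_mem_near_extend_iff {z : Completion (bassSerreTree A s)} :
    B.shadow ρ t ∈ (f.extend B z).near ↔ f ⁻¹' B.shadow ρ t ∈ z.near :=
  mem_near_extend (by simp [coboundary_shadow])

theorem shadow_invariant_or (hfix : f.extend B ρ.endpoint = ρ.endpoint)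
    (h1 : .inl 1 ∉ B.shadow ρ t) (ht : B.rayEdge ρ t ∉ f.pullbackHull B (B.rayEdge ρ t)) :
    B.shadow ρ t ⊆ f ⁻¹' B.shadow ρ t ∨ f ⁻¹' B.shadow ρ t ⊆ B.shadow ρ t := by
  by_contra! hcon
  obtain ⟨x, hx, hfx⟩ := Set.not_subset.1 hcon.1
  obtain ⟨x', hfx', hx'⟩ := Set.not_subset.1 hcon.2
  have hnear : B.shadow ρ t ∈ ρ.endpoint.near := shadow_mem_near_iff.2 rfl
  have hfnear : f ⁻¹' B.shadow ρ t ∈ ρ.endpoint.near := by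
    rwa [← shadow_mem_near_extend_iff, hfix]
  obtain ⟨y, hy, hfy⟩ := nonempty_of_mem (inter_mem hnear hfnear)
  obtain ⟨a, ha, hsa⟩ := exists_mem_pullbackEnds (B := B) (f := f) (ε := B.rayEdge ρ t)
    (x := y) (y := x) fun h => hfx ((side_rayEdge_eq_iff.1 h).1 hfy)
  obtain ⟨a', ha', hsa'⟩ := exists_mem_pullbackEnds (B := B) (f := f) (ε := B.rayEdge ρ t)
    (x := x') (y := .inl 1) fun h => h1 (f.map_one ▸ (side_rayEdge_eq_iff.1 h).1 hfx')
  have hay : B.side (B.rayEdge ρ t) a = B.side (B.rayEdge ρ t) y :=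
    hsa _ (notMem_sep.2 (side_rayEdge_eq_iff.2 (iff_of_true hy hx)))
  have hax' : B.side (B.rayEdge ρ t) a' = B.side (B.rayEdge ρ t) x' :=
    hsa' _ (notMem_sep.2 (side_rayEdge_eq_iff.2 (iff_of_false hx' h1)))
  refine ht ⟨a, ha, a', ha', ?_⟩
  rw [mem_sep, hay, hax']
  exact fun h => hx' ((side_rayEdge_eq_iff.1 h).1 hy)

theorem apply_vert_mem_shadow (ht : B.rayEdge ρ t ∉ f.pullbackHull B (B.rayEdge ρ t))
    (hf : f (ρ.vert (t + 1)) ∈ B.shadow ρ t) : f (ρ.vert t) ∈ B.shadow ρ t := by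
  by_contra hcon
  refine ht (pullback_subset_pullbackHull ?_)
  rw [f.pullback_eq_coboundary B _ (B.side (B.rayEdge ρ t) (ρ.vert (t + 1))),
    (B.joins_rayEdge ρ t).mem_coboundary_iff]
  exact fun h => hcon (h.2 hf)

theorem eventually_shadow_invariant_or (hξ : ξ.1 = ρ.endpoint) (hfix : f.extend B ξ.1 = ξ.1)
    (hcl : ξ ∉ closure (axisEndpoints A s (fixedSubgroup Φ))) :
    (∀ᶠ t in atTop, B.shadow ρ t ⊆ f ⁻¹' B.shadow ρ t) ∨
      ∀ᶠ t in atTop, B.shadow ρ t ⊆ f.symm ⁻¹' B.shadow ρ t := by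
  obtain ⟨T, hT⟩ := eventually_atTop.1 ((eventually_notMem_pullbackHull B f hξ hcl).and
    (eventually_notMem_shadow (S := B.toSidedTree) ρ (.inl 1)))
  have hor : ∀ t ≥ T, _ := fun t ht =>
    shadow_invariant_or (f := f) (hξ ▸ hfix) (hT t ht).2 (hT t ht).1
  by_cases hall : ∀ t ≥ T, B.shadow ρ t ⊆ f ⁻¹' B.shadow ρ t
  · exact .inl (eventually_atTop.2 ⟨T, hall⟩)
  push Not at hall
  obtain ⟨T', hT', hnot⟩ := hall
  have hnot' : ∀ t ≥ T', ¬ B.shadow ρ t ⊆ f ⁻¹' B.shadow ρ t := by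
    intro t ht
    induction t, ht using Nat.le_induction with
    | base => exact hnot
    | succ t ht ih =>
      intro hsub
      have hsucc : f (ρ.vert (t + 1)) ∈ B.shadow ρ (t + 1) :=
        apply_vert_mem_shadow (hT _ (by omega)).1 (hsub (vert_mem_shadow_iff.2 (by omega)))
      have hvert : f (ρ.vert t) ∈ B.shadow ρ t :=
        apply_vert_mem_shadow (hT t (by omega)).1 (shadow_antitone ρ t.le_succ hsucc)
      exact lt_irrefl t (vert_mem_shadow_iff.1 ((hor t (by omega)).resolve_left ih hvert))
  refine .inr (eventually_atTop.2 ⟨T', fun t ht x hx => ?_⟩)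
  refine (hor t (by omega)).resolve_left (hnot' t ht) ?_
  change f.toEquiv (f.toEquiv.symm x) ∈ B.shadow ρ t
  rwa [f.toEquiv.apply_symm_apply]

/-- The orbit of `x` branches off the ray `ρ` at the vertex `ρ.vert (t + 1)` and stays there for two
steps, although `f` moves the ray forward there: this obstructs convergence to the end of `ρ`. -/
structure Stalls (f : TwistedPerm A Φ) (B : BassSerreSides A s)
    (ρ : TightRay (bassSerreTree A s)) (t : ℕ) (x : TreeVertex A) : Prop where
  one_notMem : .inl 1 ∉ B.shadow ρ t
  invariant : B.shadow ρ t ⊆ f ⁻¹' B.shadow ρ t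
  invariant_succ : B.shadow ρ (t + 1) ⊆ f ⁻¹' B.shadow ρ (t + 1)
  map_vert_mem : f (ρ.vert t) ∈ B.shadow ρ t
  map_vert_succ_mem : f (ρ.vert (t + 1)) ∈ B.shadow ρ (t + 1)
  mem : x ∈ B.shadow ρ t
  map_map_notMem : f (f x) ∉ B.shadow ρ (t + 1)

namespace Stalls

variable (h : Stalls f B ρ t x)

include h

theorem map_notMem : f x ∉ B.shadow ρ (t + 1) := fun hx => h.map_map_notMem (h.invariant_succ hx)

theorem exists_mem_pullbackEnds_mem_shadow :
    ∃ a ∈ f.pullbackEnds B (B.rayEdge ρ (t + 1)), a ∈ B.shadow ρ t := by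
  obtain ⟨a, ha, hside⟩ := exists_mem_pullbackEnds (B := B) (f := f) (ε := B.rayEdge ρ (t + 1))
    (x := x) (y := ρ.vert (t + 1))
    fun hs => h.map_notMem ((side_rayEdge_eq_iff.1 hs).2 h.map_vert_succ_mem)
  have hsep : B.rayEdge ρ t ∉ B.sep x (ρ.vert (t + 1)) := notMem_sep.2 h.mem
  exact ⟨a, ha, (side_rayEdge_eq_iff.1 (hside _ hsep)).2 h.mem⟩

theorem exists_mem_pullbackEnds_notMem_shadow :
    ∃ a ∈ f.pullbackEnds B (B.rayEdge ρ (t + 1)), a ∉ B.shadow ρ t := by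
  obtain ⟨a, ha, hsep⟩ := exists_mem_pullbackEnds_mem_sep (f := f) (ε := B.rayEdge ρ (t + 1))
    (y := .inl 1) (B.joins_rayEdge ρ t).symm (Ne.symm h.one_notMem) fun hs =>
      h.one_notMem (shadow_antitone ρ t.le_succ
        (f.map_one ▸ (side_rayEdge_eq_iff.1 hs).1 h.map_vert_succ_mem))
  exact ⟨a, ha, Ne.symm hsep⟩

theorem rayEdge_mem_pullbackHull : B.rayEdge ρ t ∈ f.pullbackHull B (B.rayEdge ρ (t + 1)) := by
  obtain ⟨a, ha, hmem⟩ := h.exists_mem_pullbackEnds_mem_shadow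
  obtain ⟨a', ha', hnotMem⟩ := h.exists_mem_pullbackEnds_notMem_shadow
  exact ⟨a, ha, a', ha', fun hs => hnotMem ((side_rayEdge_eq_iff.1 hs).1 hmem)⟩

theorem exists_branch : ∃ e u, B.Joins e (ρ.vert (t + 1)) u ∧ e ∈ B.sep (ρ.vert (t + 1)) (f x) ∧
    e ≠ B.rayEdge ρ t ∧ e ≠ B.rayEdge ρ (t + 1) := by
  have hne : ρ.vert (t + 1) ≠ f x := fun hs =>
    h.map_map_notMem (hs ▸ h.map_vert_succ_mem)
  obtain ⟨e, u, hj, hsep⟩ := B.exists_first_edge hne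
  refine ⟨e, u, hj, hsep, ?_, ?_⟩
  · rintro rfl
    exact hsep (Eq.symm (h.invariant h.mem))
  · rintro rfl
    refine hsep (side_rayEdge_eq_iff.2 (iff_of_false (fun hs => ?_) h.map_notMem))
    exact lt_irrefl _ (vert_mem_shadow_iff.1 hs)

theorem branch_mem_pullbackHull (hj : B.Joins e (ρ.vert (t + 1)) u)
    (hsep : e ∈ B.sep (ρ.vert (t + 1)) (f x)) (hne : e ≠ B.rayEdge ρ t) :
    e ∈ f.pullbackHull B (B.rayEdge ρ (t + 1)) := by
  obtain ⟨a, ha, hnotMem⟩ := h.exists_mem_pullbackEnds_notMem_shadow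
  obtain ⟨a', ha', hsep'⟩ := exists_mem_pullbackEnds_mem_sep (f := f) (ε := B.rayEdge ρ (t + 1)) hj
    hsep fun hs => h.map_map_notMem ((side_rayEdge_eq_iff.1 hs).1 h.map_vert_succ_mem)
  have hea := (B.joins_rayEdge ρ t).symm.notMem_sep_of_ne hj hne (y := a) (Ne.symm hnotMem)
  refine ⟨a, ha, a', ha', ?_⟩
  rwa [mem_sep, ← notMem_sep.1 hea]

theorem exists_mem_sep_of_mem_shadow {v : TreeVertex A} (hv : v ∈ B.shadow ρ t) :
    ∃ a ∈ f.pullbackEnds B (B.rayEdge ρ t), ∃ a' ∈ f.pullbackEnds B (B.rayEdge ρ (t + 1)),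
      B.rayEdge ρ t ∈ B.sep v a ∧ B.rayEdge ρ t ∈ B.sep v a' := by
  have hvert : ρ.vert t ∉ B.shadow ρ t := fun hs => lt_irrefl t (vert_mem_shadow_iff.1 hs)
  obtain ⟨a, ha, hside⟩ := exists_mem_pullbackEnds (B := B) (f := f) (ε := B.rayEdge ρ t)
    (x := ρ.vert t) (y := .inl 1) fun hs =>
      h.one_notMem (f.map_one ▸ (side_rayEdge_eq_iff.1 hs).1 h.map_vert_mem)
  obtain ⟨a', ha', hnotMem⟩ := h.exists_mem_pullbackEnds_notMem_shadow
  have hsep : B.rayEdge ρ t ∉ B.sep (ρ.vert t) (.inl 1) :=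
    notMem_sep.2 (side_rayEdge_eq_iff.2 (iff_of_false hvert h.one_notMem))
  refine ⟨a, ha, a', ha', fun hs => hvert ?_, fun hs => hnotMem ((side_rayEdge_eq_iff.1 hs).1 hv)⟩
  exact (side_rayEdge_eq_iff.1 (hs.trans (hside _ hsep))).1 hv

theorem exists_mem_sep_of_notMem_shadow {v : TreeVertex A} (hv : v ∉ B.shadow ρ t)
    (hj : B.Joins e (ρ.vert (t + 1)) u) (hsep : e ∈ B.sep (ρ.vert (t + 1)) (f x))
    (hne : e ≠ B.rayEdge ρ (t + 1)) :
    ∃ a ∈ f.pullbackEnds B e, ∃ a' ∈ f.pullbackEnds B (B.rayEdge ρ (t + 1)),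
      B.rayEdge ρ t ∈ B.sep v a ∧ B.rayEdge ρ t ∈ B.sep v a' := by
  have hvert : B.rayEdge ρ (t + 1) ∈ B.sep (ρ.vert (t + 1)) (f (ρ.vert (t + 1))) := fun hs =>
    lt_irrefl _ (vert_mem_shadow_iff.1 ((side_rayEdge_eq_iff.1 hs).2 h.map_vert_succ_mem))
  have hfvert : B.side e (ρ.vert (t + 1)) = B.side e (f (ρ.vert (t + 1))) :=
    notMem_sep.1 ((B.joins_rayEdge ρ (t + 1)).notMem_sep_of_ne hj hne hvert)
  obtain ⟨a, ha, hside⟩ := exists_mem_pullbackEnds (B := B) (f := f) (ε := e)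
    (x := x) (y := ρ.vert (t + 1)) (hfvert ▸ Ne.symm hsep)
  obtain ⟨a', ha', hmem⟩ := h.exists_mem_pullbackEnds_mem_shadow
  have hx : B.rayEdge ρ t ∉ B.sep x (ρ.vert (t + 1)) := notMem_sep.2 h.mem
  refine ⟨a, ha, a', ha', fun hs => hv ?_, fun hs => hv ((side_rayEdge_eq_iff.1 hs).2 hmem)⟩
  exact (side_rayEdge_eq_iff.1 (hs.trans (hside _ hx))).2 h.mem

end Stalls

theorem exists_finite_stalls (B : BassSerreSides A s) (f : TwistedPerm A Φ) :
    ∃ R : Set F, R.Finite ∧ ∀ {ρ t x}, Stalls f B ρ t x →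
      (B.rayEdge ρ t).base⁻¹ * Φ (B.rayEdge ρ t).base ∈ R := by
  obtain ⟨R, hR, hull⟩ := f.exists_finite_pullbackHull B
  obtain ⟨Q, hQ, hcommon⟩ := f.exists_finite_common_sep B
  refine ⟨(Q ∪ Φ.symm '' (R * R⁻¹) * Q) * R⁻¹,
    (hQ.union (((hR.mul hR.inv).image _).mul hQ)).mul hR.inv, fun {ρ t x} h => ?_⟩
  have he := hull _ _ h.rayEdge_mem_pullbackHull
  suffices hsuff : (B.rayEdge ρ t).base⁻¹ * (B.rayEdge ρ (t + 1)).base ∈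
      Q ∪ Φ.symm '' (R * R⁻¹) * Q by
    convert Set.mul_mem_mul hsuff (Set.inv_mem_inv.2 he) using 1
    group
  by_cases hv : f.symm (ρ.vert (t + 1)) ∈ B.shadow ρ t
  · obtain ⟨a, ha, a', ha', hsep, hsep'⟩ := h.exists_mem_sep_of_mem_shadow hv
    exact .inl (hcommon (B.joins_rayEdge ρ t).symm (B.joins_rayEdge ρ (t + 1)) a ha a' ha' _
      hsep hsep')
  · obtain ⟨e, u, hj, he', hne, hne'⟩ := h.exists_branch
    obtain ⟨a, ha, a', ha', hsep, hsep'⟩ := h.exists_mem_sep_of_notMem_shadow hv hj he' hne'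
    have hbranch := hull _ _ (h.branch_mem_pullbackHull hj he' hne)
    have hQmem := hcommon hj (B.joins_rayEdge ρ (t + 1)) a ha a' ha' _ hsep hsep'
    refine .inr ⟨_, Set.mem_image_of_mem _ (Set.mul_mem_mul he (Set.inv_mem_inv.2 hbranch)), _,
      hQmem, ?_⟩
    simp

theorem eventually_shadow_subset_preimage_preimage (hξ : ξ.1 = ρ.endpoint)
    (hcl : ξ ∉ closure (axisEndpoints A s (fixedSubgroup Φ)))
    (hinv : ∀ᶠ t in atTop, B.shadow ρ t ⊆ f ⁻¹' B.shadow ρ t) :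
    ∀ᶠ t in atTop, B.shadow ρ t ⊆ f ⁻¹' (f ⁻¹' B.shadow ρ (t + 1)) := by
  obtain ⟨R, hR, hstalls⟩ := exists_finite_stalls B f
  have hvert : ∀ᶠ t in atTop, f (ρ.vert t) ∈ B.shadow ρ t := by
    filter_upwards [eventually_notMem_pullbackHull B f hξ hcl, hinv] with t ht hsub
    exact apply_vert_mem_shadow ht (hsub (vert_mem_shadow_iff.2 t.lt_succ_self))
  filter_upwards [eventually_displacement_notMem (B := B) hξ hcl hR,
    eventually_notMem_shadow (S := B.toSidedTree) ρ (.inl 1), hinv, hvert,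
    (tendsto_add_atTop_nat 1).eventually hinv, (tendsto_add_atTop_nat 1).eventually hvert]
    with t hdisp h1 hsub hfv hsub' hfv' x hx
  by_contra hnot
  exact hdisp (hstalls ⟨h1, hsub, hsub', hfv, hfv', hx, hnot⟩)

theorem tendsto_iterate_of_shadow_mem_near (hξ : ξ.1 = ρ.endpoint) {T : ℕ}
    (hinv : ∀ t ≥ T, B.shadow ρ t ⊆ f ⁻¹' B.shadow ρ t)
    (hadv : ∀ t ≥ T, B.shadow ρ t ⊆ f ⁻¹' (f ⁻¹' B.shadow ρ (t + 1))) {ζ : Boundary A s}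
    (hζ : B.shadow ρ T ∈ ζ.1.near) :
    Tendsto (fun m : ℕ => (f.boundaryHomeo B)^[m] ζ) atTop (𝓝 ξ) := by
  have hsucc (m : ℕ) : ((f.boundaryHomeo B)^[m + 1] ζ).1 =
      f.extend B ((f.boundaryHomeo B)^[m] ζ).1 := by
    rw [Function.iterate_succ_apply', boundaryHomeo_apply]
  have hreach : ∀ t ≥ T, ∀ᶠ m : ℕ in atTop,
      B.shadow ρ t ∈ ((f.boundaryHomeo B)^[m] ζ).1.near := by
    intro t ht
    induction t, ht using Nat.le_induction with
    | base =>
      refine .of_forall fun m => ?_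
      induction m with
      | zero => exact hζ
      | succ m ih =>
        rw [hsucc, shadow_mem_near_extend_iff]
        exact mem_of_superset ih (hinv T le_rfl)
    | succ t ht ih =>
      rw [← map_add_atTop_eq_nat 2, eventually_map]
      filter_upwards [ih] with m hm
      rw [hsucc, hsucc, shadow_mem_near_extend_iff,
        mem_near_extend (coboundary_preimage_finite (by simp [coboundary_shadow]))]
      exact mem_of_superset hm (hadv t ht)
  rw [tendsto_subtype_rng, hξ]
  refine tendsto_nhds_endpoint (S := B.toSidedTree) fun t => ?_
  filter_upwards [hreach (max T t) (le_max_left T t)] with m hm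
  exact mem_of_superset hm (shadow_antitone ρ (le_max_right T t))

theorem isAttractor_of_shadow_invariant (hξ : ξ.1 = ρ.endpoint)
    (hcl : ξ ∉ closure (axisEndpoints A s (fixedSubgroup Φ)))
    (hinv : ∀ᶠ t in atTop, B.shadow ρ t ⊆ f ⁻¹' B.shadow ρ t) :
    IsAttractor (f.boundaryHomeo B) ξ := by
  obtain ⟨T, hT⟩ := eventually_atTop.1
    (hinv.and (eventually_shadow_subset_preimage_preimage hξ hcl hinv))
  refine ⟨{ζ | B.shadow ρ T ∈ ζ.1.near},
    (B.isOpen_shadow_mem_near ρ T).preimage continuous_subtype_val, ?_, fun ζ hζ =>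
      tendsto_iterate_of_shadow_mem_near hξ (fun t ht => (hT t ht).1) (fun t ht => (hT t ht).2) hζ⟩
  change B.shadow ρ T ∈ ξ.1.near
  rw [shadow_mem_near_iff, hξ]

theorem IsAttractor.isIsolatedIn {X : Type*} [TopologicalSpace X] [T2Space X] {h : X ≃ₜ X} {p : X}
    (ha : IsAttractor h p) (hp : p ∈ Function.fixedPoints h) :
    IsIsolatedIn (Function.fixedPoints h) p := by
  obtain ⟨U, hU, hpU, hlim⟩ := ha
  refine ⟨U, hU, Set.Subset.antisymm ?_ (Set.singleton_subset_iff.2 ⟨hpU, hp⟩)⟩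
  rintro q ⟨hqU, hq⟩
  have hconst := hlim q hqU
  simp only [Function.iterate_fixed hq] at hconst
  exact tendsto_nhds_unique tendsto_const_nhds hconst

theorem IsRepeller.isIsolatedIn {X : Type*} [TopologicalSpace X] [T2Space X] {h : X ≃ₜ X} {p : X}
    (hr : IsRepeller h p) (hp : p ∈ Function.fixedPoints h) :
    IsIsolatedIn (Function.fixedPoints h) p := by
  have hsymm : Function.fixedPoints h.symm = Function.fixedPoints h :=
    Function.fixedPoints_symm (e := h.toEquiv)
  exact hsymm ▸ IsAttractor.isIsolatedIn hr (hsymm ▸ hp)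

theorem isAttractor_or_isRepeller (hinf : ξ ∈ boundaryInfty A s)
    (hfix : ξ ∈ Function.fixedPoints (f.boundaryHomeo B))
    (hcl : ξ ∉ closure (axisEndpoints A s (fixedSubgroup Φ))) :
    IsAttractor (f.boundaryHomeo B) ξ ∨ IsRepeller (f.boundaryHomeo B) ξ := by
  obtain ⟨e, he⟩ := hinf
  induction e using Quotient.inductionOn with
  | _ ρ =>
    refine (eventually_shadow_invariant_or (f := f) (B := B) he (congrArg Subtype.val hfix)
      hcl).imp (isAttractor_of_shadow_invariant he hcl) fun hinv => ?_
    rw [IsRepeller, boundaryHomeo_symm]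
    exact isAttractor_of_shadow_invariant he (by rwa [fixedSubgroup_symm]) hinv

end Dynamics

end FreeProductBoundary

theorem mainTheorem5_general {F : Type*} [Group F] {n k : ℕ} (A : Fin n → Subgroup F)
    (s : Fin k → F) (hF : IsFreeProductDecomposition A s) (Φ : F ≃* F) (hΦ : PermutesFactors A Φ) :
    ∃ Φhat : Boundary A s ≃ₜ Boundary A s,
      IsBoundaryExtension A s Φ Φhat ∧
      (∀ h : Boundary A s → Boundary A s, IsBoundaryExtension A s Φ h → h = Φhat) ∧
      (subgroupBoundary A s (fixedSubgroup Φ) ∩ boundaryInfty A s =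
          closure (axisEndpoints A s (fixedSubgroup Φ)) ∩ boundaryInfty A s) ∧
      ((subgroupBoundary A s (fixedSubgroup Φ) ∩ boundaryInfty A s).Nonempty →
        subgroupBoundary A s (fixedSubgroup Φ) =
          closure (axisEndpoints A s (fixedSubgroup Φ)) ∧
        ∀ ξ ∈ subgroupBoundary A s (fixedSubgroup Φ), ξ ∈ Function.fixedPoints Φhat ∧
          (3 ≤ (Function.fixedPoints Φhat).encard →
            ¬ IsIsolatedIn (Function.fixedPoints Φhat) ξ)) ∧
      ∀ ξ ∈ (Function.fixedPoints Φhat \ subgroupBoundary A s (fixedSubgroup Φ)) ∩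
          boundaryInfty A s,
        IsIsolatedIn (Function.fixedPoints Φhat) ξ ∧
        (IsAttractor Φhat ξ ∨ IsRepeller Φhat ξ) := by
  obtain ⟨B⟩ := hF.nonempty_sides
  obtain ⟨f⟩ := hΦ.nonempty_twistedPerm
  have hinter := subgroupBoundary_inter_boundaryInfty B (fixedSubgroup Φ)
  refine ⟨f.boundaryHomeo B, TwistedPerm.isBoundaryExtension_boundaryHomeo, fun h hh =>
    hh.unique B TwistedPerm.isBoundaryExtension_boundaryHomeo, hinter, fun hne => ?_,
    fun ξ ⟨⟨hfix, hξ⟩, hinf⟩ => ?_⟩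
  · rw [hinter] at hne
    have heq := subgroupBoundary_eq_closure B f (closure_nonempty_iff.1 hne.left)
    refine ⟨heq, fun ξ hξ => ?_⟩
    rw [heq] at hξ
    exact ⟨closure_axisEndpoints_subset hξ, fun h3 => not_isIsolatedIn_of_mem_closure h3 hξ⟩
  · have := B.t2Space_completion
    have hcl : ξ ∉ closure (axisEndpoints A s (fixedSubgroup Φ)) := fun hcl =>
      hξ (hinter.superset ⟨hcl, hinf⟩).1
    have hor := isAttractor_or_isRepeller hinf hfix hcl
    exact ⟨hor.elim (·.isIsolatedIn hfix) (·.isIsolatedIn hfix), hor⟩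

theorem mainTheorem5 {F : Type*} [Group F] {n k : ℕ} (A : Fin n → Subgroup F) (s : Fin k → F)
    (hF : IsFreeProductDecomposition A s) (Φ : F ≃* F) (hΦ : PermutesFactors A Φ) :
    -- the homeomorphism of the boundary induced by `Φ` exists and is unique,
    ∃ Φhat : Boundary A s ≃ₜ Boundary A s,
      IsBoundaryExtension A s Φ Φhat ∧
      (∀ h : Boundary A s → Boundary A s, IsBoundaryExtension A s Φ h → h = Φhat) ∧
      -- and if it has at least three fixed points in `∂_∞(F, 𝒜)`, then:
      (3 ≤ (Function.fixedPoints Φhat ∩ boundaryInfty A s).encard →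
        -- the boundary of the fixed subgroup,
        (subgroupBoundary A s (fixedSubgroup Φ) ∩ boundaryInfty A s =
            closure (axisEndpoints A s (fixedSubgroup Φ)) ∩ boundaryInfty A s) ∧
        ((subgroupBoundary A s (fixedSubgroup Φ) ∩ boundaryInfty A s).Nonempty →
          subgroupBoundary A s (fixedSubgroup Φ) =
            closure (axisEndpoints A s (fixedSubgroup Φ)) ∧
          ∀ ξ ∈ subgroupBoundary A s (fixedSubgroup Φ),
            ξ ∈ Function.fixedPoints Φhat ∧ ¬ IsIsolatedIn (Function.fixedPoints Φhat) ξ) ∧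
        -- and the other fixed points at infinity
        (∀ ξ ∈ (Function.fixedPoints Φhat \ subgroupBoundary A s (fixedSubgroup Φ)) ∩
            boundaryInfty A s,
          IsIsolatedIn (Function.fixedPoints Φhat) ξ ∧
          (IsAttractor Φhat ξ ∨ IsRepeller Φhat ξ))) := by
  obtain ⟨Φhat, hext, hunique, hinter, hclosure, hdynamics⟩ := mainTheorem5_general A s hF Φ hΦ
  exact ⟨Φhat, hext, hunique, fun h3 => ⟨hinter, fun hne => (hclosure hne).imp_right fun h ξ hξ =>
    (h ξ hξ).imp_right (· (h3.trans (Set.encard_le_encard Set.inter_subset_left))), hdynamics⟩⟩
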